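/- **Setting.** Let $(c_i)_{i\ge1}$ (privacy sensitivities of the sellers) be i.i.d. with density $f_C$ carried by $[0,\infty)$ and distribution function $F_C$. Let the data points $z^i=(\boldsymbol x^i,y^i)$ be i.i.d. from a distribution $\mathcal D$ on $\mathbb R^n\times\{1,-1\}$ with $\|\boldsymbol x^i\|\le 1$, independent of the sensitivities. Assume that the virtual cost $\psi(c)=c+F_C(c)/f_C(c)$ is strictly increasing on the set where $f_C>0$ (where $f_C=0$, put $\psi=+\infty$), that $0<f_C<\infty$ on some interval $[0,c_1]$ with $c_1>0$, that $f_C$ is right-continuous at $0$, and that almost surely the data are linearly separable: for some $\rho>0$ there is $\boldsymbol w^*$ with $\|\boldsymbol w^*\|=1$ and $y^i\,\boldsymbol w^{*T}\boldsymbol x^i\ge\rho$ for all $i$. Write $f_\Psi$ for the density of $\psi(c_i)$; in particular $f_\Psi(0)$ is the right derivative of $t\mapsto\mathbb P(\psi(c_i)<t)$ at $0$. Below, $\ln$ is the natural logarithm and $\log$ is the logarithm to base $2$. **Algorithm.** The buyer plans for $m$ sellers, but only $N=\lfloor\xi m\rfloor$ arrive, where $\xi\in(0,1]$. Given hyperparameters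 $\mu,\sigma,\gamma>0$, put $\tilde\lambda=\sqrt{\mu^2\gamma/(\sigma m f_\Psi(0))}$. On arrival, seller $i\le N$ is offered the privacy guarantee $$\tilde\epsilon_i=\tilde\epsilon(c_i),\qquad \tilde\epsilon(c)=\frac{2\sqrt3\,\gamma^{3/2}\mu\,(\tilde\lambda-\gamma\psi(c))}{f_\Psi(0)^{3/2}m^{3/2}\tilde\lambda^{7/2}}\ \text{ if }\gamma\psi(c)<\tilde\lambda,\qquad \tilde\epsilon(c)=0\ \text{ otherwise,}$$ and the payment $\tilde t_i=-\int_{c_i}^\infty z\,\tilde\epsilon'(z)\,dz$. With $\tilde\eta=\sum_{i\le N}\tilde\epsilon_i$ and $\tilde a_i=\tilde\epsilon_i/\tilde\eta$, the weights $\tilde{\boldsymbol w}$ minimize over $\boldsymbol w\in\mathbb R^n$ $$\sum_{i\le N}\tilde a_i\log\bigl(1+e^{-y^i\boldsymbol w^T\boldsymbol x^i}\bigr)+\frac{2\boldsymbol b^T\boldsymbol w}{\tilde\eta}+\frac\Lambda2\|\boldsymbol w\|^2$$ for some $\Lambda>0$ (which may be tuned to the sample), where $\boldsymbol b$ is independent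 of the sensitivities and of the data, $\|\boldsymbol b\|\sim\Gamma(n,1)$, and the direction of $\boldsymbol b$ is uniform on the sphere and independent of $\|\boldsymbol b\|$. The buyer's objective is $$\mathcal J_m=\mathbb P_{(\boldsymbol x,y)\sim\mathcal D}\bigl(\mathrm{sign}(\tilde{\boldsymbol w}^T\boldsymbol x)\ne y\bigr)+\gamma\sum_{i\le N}\tilde t_i .$$ **Choice of the hyperparameters.** Fix $\beta,\gamma,\nu>0$. Put $v(t)=\sum_{i=0}^{n-1}\frac{(t/2)^i}{i!}e^{-t/2}$ and $$\mu(\delta,\beta)=\frac{3\ln\frac1\delta}{\sqrt2}\log(1+e^\beta)+\frac{\beta}{\ln2},\qquad \sigma(\delta,\delta',\beta)=\Bigl(\frac{6\ln\frac1\delta}{\sqrt2}+1\Bigr)\,2\beta\, v^{-1}(\delta').$$ Take $\mu=\mu(\delta,\beta)$ and $\sigma=\sigma(\delta,\delta',\beta)$ with $$\delta=\exp\Bigl(-\frac{\sqrt2\,\nu\,m^{1/4}}{\sqrt3\,E_m\,\gamma^{1/4}\log(1+e^\beta)}\Bigr),$$ where $E_m$ is any sequence (for instance a constant one) with $$\lim_{m\to\infty}E_m=f_\Psi(0)^{-1/4}\bigl(2\xi^{-1/2}+\xi^{-1}+3\xi\bigr),$$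 and with $\delta'\in(0,1)$ such that $\sigma=\mu^2$ (for all large $m$). **Theorem.** For every $\nu>0$ and the above choice of the hyperparameters, there is a deterministic $\mathrm o(1)$, which tends to $0$ as $m\to\infty$, such that $$\mathbb P\Bigl(\|\tilde{\boldsymbol w}\|=\beta\ \text{ and }\ \mathcal J_m\ge\log(1+e^{-\rho\beta})+\nu+\mathrm o(1)\Bigr)\le\mathcal O\Bigl(e^{-\nu\xi m^{1/4}/(2\beta)}\Bigr).$$ The constant in $\mathcal O$ may depend on everything except $m$. -/

import Mathlib

open MeasureTheory ProbabilityTheory Filter Topology Asymptotics Set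

namespace DataMarket

noncomputable section

/-- Feature space `ℝⁿ` with the Euclidean norm. -/
abbrev Feat (n : ℕ) : Type := EuclideanSpace ℝ (Fin n)

/-- A data point `(x, y)`: feature vector `x` and label `y` (the label is `1` or `-1`). -/
abbrev DataPoint (n : ℕ) : Type := Feat n × ℝ

/-! ## Privacy sensitivities and virtual costs -/

/-- The law on `ℝ` with density `f`. -/
def costLaw (f : ℝ → ℝ) : Measure ℝ := volume.withDensity fun c => ENNReal.ofReal (f c)

/-- `f` is a probability density on the line, carried by `[0, ∞)`. -/
structure IsCostDensity (f : ℝ → ℝ) : Prop where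
  measurable : Measurable f
  nonneg : ∀ c, 0 ≤ f c
  eq_zero_of_neg : ∀ c, c < 0 → f c = 0
  isProbabilityMeasure : IsProbabilityMeasure (costLaw f)

/-- The cumulative distribution function of the density `f`. -/
def costCDF (f : ℝ → ℝ) (c : ℝ) : ℝ := (costLaw f).real (Iic c)

/-- The virtual cost `ψ(c) = c + F(c) / f(c)`. It is meaningful where `0 < f c`; elsewhere the
virtual cost is infinite, and the definitions below never use the real number given here. -/
def virtualCost (f : ℝ → ℝ) (c : ℝ) : ℝ := c + costCDF f c / f c

/-- The density of the virtual cost `ψ(c)` of a random seller: the (right) derivative of the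
distribution function `t ↦ ℙ(ψ(c) < t)`. The virtual cost is nonnegative, so that at the point `0`
only the derivative from the right makes sense. -/
def virtualCostDensity (f : ℝ → ℝ) (x : ℝ) : ℝ :=
  derivWithin (fun t => (costLaw f).real {c | 0 < f c ∧ virtualCost f c < t}) (Ici x) x

/-! ## The hyperparameters -/

/-- The logistic loss of a margin, with logarithms to base `2`. -/
def logisticLoss (s : ℝ) : ℝ := Real.logb 2 (1 + Real.exp (-s))

/-- `μ(δ, β) = (3 ln(1/δ) / √2) log(1 + e^β) + β / ln 2`, where `log` is to base `2`. -/
def muParam (δ β : ℝ) : ℝ :=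
  3 * Real.log (1 / δ) / √2 * Real.logb 2 (1 + Real.exp β) + β / Real.log 2

/-- `v(t) = ∑_{i < n} (t/2)^i / i! * e^{-t/2}`. -/
def gammaTail (n : ℕ) (t : ℝ) : ℝ :=
  ∑ i ∈ Finset.range n, (t / 2) ^ i / (i.factorial : ℝ) * Real.exp (-t / 2)

/-- The inverse `v⁻¹` of the decreasing bijection `v` from `[0, ∞)` onto `(0, 1]` (`n ≥ 1`). -/
def gammaTailInv (n : ℕ) : ℝ → ℝ := Function.invFunOn (gammaTail n) (Ici 0)

/-- `σ(δ, δ', β) = (6 ln(1/δ) / √2 + 1) * (2 β v⁻¹(δ'))`. -/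
def sigmaParam (n : ℕ) (δ δ' β : ℝ) : ℝ :=
  (6 * Real.log (1 / δ) / √2 + 1) * (2 * β * gammaTailInv n δ')

/-- The constant of the bound on the proxy loss of the online algorithm, all values of the density
of the virtual cost near `0` being replaced by its value `p` at `0`. -/
def proxyConst (ξ p : ℝ) : ℝ :=
  2 * p ^ (1 / 2 : ℝ) * p ^ (1 / 4 : ℝ) / (ξ ^ (1 / 2 : ℝ) * p)
    + p ^ (3 / 4 : ℝ) / (ξ * p)
    + 3 * ξ * p / p ^ (5 / 4 : ℝ)

/-- The rate `√2 / (√3 E γ^{1/4} log(1 + e^β))` in the choice of `δ`. -/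
def deltaRate (E γ β : ℝ) : ℝ :=
  √2 / (√3 * E * γ ^ (1 / 4 : ℝ) * Real.logb 2 (1 + Real.exp β))

/-! ## The online algorithm -/

/-- The cut-off price `√(μ² γ / (σ m p))`, where `p` is the density of the virtual cost at `0`. -/
def cutoff (μ σ γ p : ℝ) (m : ℕ) : ℝ := √(μ ^ 2 * γ / (σ * m * p))

open Classical in
/-- The privacy guarantee offered on arrival to a seller who reports `c`. Sellers with
`γ ψ(c) ≥ λ` (in particular with infinite virtual cost) receive `0`. -/
def onlineEps (f : ℝ → ℝ) (μ σ γ : ℝ) (m : ℕ) (c : ℝ) : ℝ :=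
  let p := virtualCostDensity f 0
  let lam := cutoff μ σ γ p m
  if 0 < f c ∧ γ * virtualCost f c < lam then
    2 * √3 * γ ^ (3 / 2 : ℝ) * μ * (lam - γ * virtualCost f c)
      / (p ^ (3 / 2 : ℝ) * (m : ℝ) ^ (3 / 2 : ℝ) * lam ^ (7 / 2 : ℝ))
  else 0

/-- The payment identity `t = -∫_c^∞ z (dε/dz) dz` for a seller who reports `c` and whose guarantee
as a function of the own report is `eps`. -/
def payment (eps : ℝ → ℝ) (c : ℝ) : ℝ := -∫ z in Ioi c, z * deriv eps z

/-- The total `η = ∑ i < N, ε_i` of the privacy guarantees. -/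
def totalEps (N : ℕ) (eps : ℕ → ℝ) : ℝ := ∑ i ∈ Finset.range N, eps i

/-- The objective of differentially private logistic regression on the data `z_0, …, z_{N-1}` with
privacy guarantees `eps`, noise vector `b` and ridge parameter `Λ`:
`∑ a_i log(1 + exp(-y_i w·x_i)) + 2 b·w / η + Λ/2 ‖w‖²` with `a_i = ε_i / η`. -/
def trainObjective {n : ℕ} (N : ℕ) (eps : ℕ → ℝ) (z : ℕ → DataPoint n) (b : Feat n) (Λ : ℝ)
    (w : Feat n) : ℝ :=
  ∑ i ∈ Finset.range N,
      eps i / totalEps N eps * logisticLoss ((z i).2 * inner ℝ w (z i).1)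
    + 2 * inner ℝ b w / totalEps N eps + Λ / 2 * ‖w‖ ^ 2

/-- The law of the noise vector: norm with distribution `Γ(n, 1)`, and independently of it a
direction that is uniform on the unit sphere. -/
def noiseLaw (n : ℕ) : Measure (Feat n) :=
  ((gammaMeasure (n : ℝ) 1).prod
      ((volume : Measure (Feat n)).toSphere[|(univ : Set (Metric.sphere (0 : Feat n) 1))])).map
    fun q => q.1 • (q.2 : Feat n)

/-- The misclassification (test) loss `ℙ_{(x,y) ∼ 𝒟}(sign(w·x) ≠ y)`. -/
def testLoss {n : ℕ} (𝒟 : Measure (DataPoint n)) (w : Feat n) : ℝ :=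
  𝒟.real {z | Real.sign (inner ℝ w z.1) ≠ z.2}

/-- The buyer's objective: test loss plus `γ` times the total payment to the `N` sellers. -/
def buyerObjective {n : ℕ} (𝒟 : Measure (DataPoint n)) (γ : ℝ) (N : ℕ) (w : Feat n)
    (t : ℕ → ℝ) : ℝ :=
  testLoss 𝒟 w + γ * ∑ i ∈ Finset.range N, t i

/-- `w` is the output of the online algorithm, with arrivals `c_0, …, c_{N-1}` and data
`z_0, …, z_{N-1}`, noise vector `b` and some ridge parameter `Λ > 0`. -/
def IsOnlineSolution {n : ℕ} (f : ℝ → ℝ) (μ σ γ : ℝ) (m N : ℕ) (c : ℕ → ℝ)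
    (z : ℕ → DataPoint n) (b : Feat n) (w : Feat n) : Prop :=
  ∃ Λ : ℝ, 0 < Λ ∧
    IsMinOn (trainObjective N (fun i => onlineEps f μ σ γ m (c i)) z b Λ) univ w

end

end DataMarket

open DataMarket

/-!
The theorem holds with the `o(1)` term equal to `0` and with a failure probability that is
exponentially small in `√m`, which is smaller than the required bound in `m^{1/4}`.

Since `f` is right-continuous and positive at `0`, `F(c) / f(c) ~ c`, so that `ψ(c) ~ 2 c` and the
virtual cost has density `p = f(0) / 2` at `0` (`tendsto_virtualCost_div`,
`virtualCostDensity_zero`). With `σ = μ²` the guarantee is `ε(c) = a (T - ψ(c))⁺` with threshold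
`T = (γ m p)^{-1/2}` (`onlineEps_eq_linearEps`); its maximum `h = a T` converges to
`H = 6 ν / (2 ξ^{-1/2} + ξ^{-1} + 3 ξ)` by the choice of `δ` (`tendsto_maxEps`), and `ξ H ≤ ν`
because `ξ ≤ 1`. The number of sellers with a positive guarantee is binomial with mean of order
`s = ξ m p T`, which is a multiple of `√m`.

*Payments.* Only sellers with `ψ(c) < T` are paid; they have `c ≤ d` with `d` close to `T / 2`, and
the guarantee is antitone, so each of them gets at most `d h` (`payment_linearEps_le`). As
`γ T s = ξ`, the payments contribute at most about `γ d h s ≈ ξ h / 2`, hence up to Chernoff losses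
less than `4 ν / 5`.

*Test loss.* The logistic loss dominates the misclassification loss. On the sphere `‖w‖ = β` the
ridge term takes the same value at the minimizer and at `β w*`, so the weighted training loss of the
minimizer is at most `log (1 + e^{-ρβ}) + 4 β ‖b‖ / η` (`weightedLoss_minimizer_le`). The total
guarantee `η` is of order `√m` while `‖b‖` has an exponential tail (`noiseLaw_norm_ge_le`). The
weighted training loss is close to the expected loss on a finite net of the sphere, whose size does
not depend on `m`, by Hoeffding's inequality conditionally on the sensitivities
(`measure_random_weighted_deviation_le`), and the loss is Lipschitz in `w`. These errors add
up to at most `ν / 5`. The estimates are combined in `failure_probability_le`.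
-/

namespace DataMarket


/-! ### The virtual cost near zero -/

lemma IsCostDensity.integrable {f : ℝ → ℝ} (hf : IsCostDensity f) : Integrable f := by
  have h1 := hf.isProbabilityMeasure.measure_univ
  rw [costLaw, withDensity_apply _ MeasurableSet.univ, Measure.restrict_univ] at h1
  refine ⟨hf.measurable.aestronglyMeasurable, ?_⟩
  rw [hasFiniteIntegral_iff_ofReal (ae_of_all _ hf.nonneg), h1]
  exact ENNReal.one_lt_top

lemma costLaw_Iio_zero {f : ℝ → ℝ} (hf : IsCostDensity f) : costLaw f (Iio 0) = 0 := by
  rw [costLaw, withDensity_apply _ measurableSet_Iio,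
    setLIntegral_congr_fun (g := fun _ => 0) measurableSet_Iio
      (fun x hx => by simp [hf.eq_zero_of_neg x hx])]
  simp

lemma ae_costLaw_nonneg {f : ℝ → ℝ} (hf : IsCostDensity f) : ∀ᵐ c ∂costLaw f, 0 ≤ c := by
  rw [ae_iff]
  simpa [Iio_def] using costLaw_Iio_zero hf

lemma costCDF_eq_integral {f : ℝ → ℝ} (hf : IsCostDensity f) {c : ℝ} (hc : 0 ≤ c) :
    costCDF f c = ∫ x in (0 : ℝ)..c, f x := by
  have h0 : ∀ᵐ x, x ∈ Iic c → x ∉ Ioc 0 c → f x = 0 := by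
    have : ∀ᵐ x : ℝ, x ≠ 0 := by simp [ae_iff]
    filter_upwards [this] with x hx h1 h2
    apply hf.eq_zero_of_neg
    by_contra h3
    exact h2 ⟨lt_of_le_of_ne (not_lt.1 h3) hx.symm, h1⟩
  rw [costCDF, costLaw, Measure.real, withDensity_apply _ measurableSet_Iic,
    ← ofReal_integral_eq_lintegral_ofReal hf.integrable.integrableOn (ae_of_all _ hf.nonneg),
    ENNReal.toReal_ofReal (integral_nonneg hf.nonneg), intervalIntegral.integral_of_le hc]
  exact setIntegral_eq_of_subset_of_ae_sdiff_eq_zero measurableSet_Iic.nullMeasurableSet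
    Ioc_subset_Iic_self (by filter_upwards [h0] with x hx h; exact hx h.1 h.2)

lemma costCDF_nonneg (f : ℝ → ℝ) (c : ℝ) : 0 ≤ costCDF f c := measureReal_nonneg

lemma monotone_costCDF {f : ℝ → ℝ} (hf : IsCostDensity f) : Monotone (costCDF f) := by
  have := hf.isProbabilityMeasure
  exact fun a b hab => measureReal_mono (Iic_subset_Iic.2 hab)

lemma measurable_virtualCost {f : ℝ → ℝ} (hf : IsCostDensity f) :
    Measurable (virtualCost f) :=
  measurable_id.add ((monotone_costCDF hf).measurable.div hf.measurable)

lemma le_virtualCost {f : ℝ → ℝ} (hf : IsCostDensity f) (c : ℝ) : c ≤ virtualCost f c := by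
  have := div_nonneg (costCDF_nonneg f c) (hf.nonneg c)
  simp only [virtualCost]; linarith

lemma nonneg_of_density_pos {f : ℝ → ℝ} (hf : IsCostDensity f) {c : ℝ} (hc : 0 < f c) :
    0 ≤ c := by
  by_contra h
  exact hc.ne' (hf.eq_zero_of_neg c (not_le.1 h))

lemma costCDF_zero {f : ℝ → ℝ} (hf : IsCostDensity f) : costCDF f 0 = 0 := by
  simp [costCDF_eq_integral hf le_rfl]

lemma tendsto_costCDF_div {f : ℝ → ℝ} (hf : IsCostDensity f)
    (hf_cont : ContinuousWithinAt f (Ici 0) 0) :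
    Tendsto (fun c => costCDF f c / c) (𝓝[>] 0) (𝓝 (f 0)) := by
  have h := intervalIntegral.integral_hasDerivWithinAt_right (a := (0 : ℝ)) (b := 0) (s := Ici 0)
    (t := Ioi 0) (f := f) (by simp)
    hf.measurable.stronglyMeasurable.stronglyMeasurableAtFilter
    (hf_cont.mono Ioi_subset_Ici_self)
  rw [hasDerivWithinAt_iff_tendsto_slope, Ici_sdiff_left] at h
  refine h.congr' ?_
  filter_upwards [self_mem_nhdsWithin] with c hc
  rw [slope_def_field, costCDF_eq_integral hf (le_of_lt hc)]
  simp

/-- Near `0` the distribution function is linear with slope `f 0`, so that `F / f` and `c` agree to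
first order and the virtual cost is asymptotic to `2 c`. -/
lemma tendsto_virtualCost_div {f : ℝ → ℝ} (hf : IsCostDensity f) (hf0 : 0 < f 0)
    (hf_cont : ContinuousWithinAt f (Ici 0) 0) :
    Tendsto (fun c => virtualCost f c / c) (𝓝[>] 0) (𝓝 2) := by
  have h1 := (tendsto_costCDF_div hf hf_cont).div
    (hf_cont.tendsto.mono_left (nhdsWithin_mono _ Ioi_subset_Ici_self)) hf0.ne'
  rw [div_self hf0.ne'] at h1
  have h2 := h1.const_add 1
  rw [one_add_one_eq_two] at h2
  refine h2.congr' ?_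
  filter_upwards [self_mem_nhdsWithin] with c hc
  have hc : c ≠ 0 := ne_of_gt hc
  simp only [virtualCost, Pi.div_apply]
  rw [add_div, div_self hc, div_div, div_div, mul_comm]

/-- For small thresholds `t`, the sellers of virtual cost below `t` are, up to a factor close to
`1`, those of sensitivity below `t / 2`. -/
lemma eventually_virtualCost_lt {f : ℝ → ℝ} (hf : IsCostDensity f)
    (hψ : StrictMonoOn (virtualCost f) {c | 0 ≤ c ∧ 0 < f c})
    (hf_pos : ∃ c₁ > 0, ∀ c ∈ Icc (0 : ℝ) c₁, 0 < f c)
    (hf_cont : ContinuousWithinAt f (Ici 0) 0) {κ : ℝ} (hκ : 0 < κ) (hκ1 : κ < 1) :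
    ∀ᶠ t in 𝓝[>] (0 : ℝ),
      (∀ c, 0 < f c → virtualCost f c < t → c ≤ (1 + κ) * t / 2) ∧
      (∀ c ∈ Icc 0 ((1 - κ) * t / 2), 0 < f c ∧ virtualCost f c < t) := by
  obtain ⟨c₁, hc₁, hpos⟩ := hf_pos
  have hf0 : 0 < f 0 := hpos 0 ⟨le_rfl, hc₁.le⟩
  have hlim := tendsto_virtualCost_div hf hf0 hf_cont
  have hlo : 2 / (1 + κ) < 2 := by rw [div_lt_iff₀ (by linarith)]; linarith
  have hhi : 2 < 2 / (1 - κ) := by rw [lt_div_iff₀ (by linarith)]; linarith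
  have hev : ∀ᶠ c in 𝓝[>] (0 : ℝ), 2 / (1 + κ) < virtualCost f c / c ∧
      virtualCost f c / c < 2 / (1 - κ) :=
    (hlim.eventually_const_lt hlo).and (hlim.eventually_lt_const hhi)
  obtain ⟨c₂, hc₂, h₂⟩ := (mem_nhdsGT_iff_exists_Ioo_subset).1 hev
  have hc₂ : 0 < c₂ := hc₂
  set c₃ := min c₁ (c₂ / 2) with hc₃
  have hc₃0 : 0 < c₃ := lt_min hc₁ (by linarith)
  have hc₃1 : c₃ ≤ c₁ := min_le_left _ _
  have hc₃2 : c₃ < c₂ := lt_of_le_of_lt (min_le_right _ _) (by linarith)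
  have hb : ∀ c, 0 < c → c ≤ c₃ → 2 / (1 + κ) * c < virtualCost f c ∧
      virtualCost f c < 2 / (1 - κ) * c := by
    intro c hc hc'
    have := h₂ ⟨hc, hc'.trans_lt hc₃2⟩
    exact ⟨(lt_div_iff₀ hc).1 this.1, (div_lt_iff₀ hc).1 this.2⟩
  have hψ₃ : 0 < virtualCost f c₃ := hc₃0.trans_le (le_virtualCost hf _)
  have ht : ∀ᶠ t in 𝓝[>] (0 : ℝ), 0 < t ∧ t < virtualCost f c₃ ∧ t < c₃ := by
    filter_upwards [Ioo_mem_nhdsGT hψ₃, Ioo_mem_nhdsGT hc₃0] with t h1 h2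
    exact ⟨h1.1, h1.2, h2.2⟩
  filter_upwards [ht] with t ⟨ht0, ht1, ht2⟩
  constructor
  · intro c hc hct
    have hc0 := nonneg_of_density_pos hf hc
    -- monotonicity of `ψ` excludes cheap sellers away from `0`
    have hcc : c < c₃ := by
      by_contra h
      have := hψ.monotoneOn ⟨hc₃0.le, hpos _ ⟨hc₃0.le, hc₃1⟩⟩ ⟨hc0, hc⟩ (not_lt.1 h)
      linarith
    rcases hc0.eq_or_lt with h | h
    · rw [← h]; positivity
    · have := (hb c h hcc.le).1.trans hct
      rw [div_mul_eq_mul_div, div_lt_iff₀ (by linarith)] at this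
      linarith
  · intro c hc
    have hcc : c ≤ c₃ := by
      have : (1 - κ) * t ≤ 1 * t := by gcongr; linarith
      linarith [hc.2]
    refine ⟨hpos c ⟨hc.1, hcc.trans hc₃1⟩, ?_⟩
    rcases hc.1.eq_or_lt with h | h
    · rw [← h]; simpa [virtualCost, costCDF_zero hf] using ht0
    · refine (hb c h hcc).2.trans_le ?_
      rw [div_mul_eq_mul_div, div_le_iff₀ (by linarith)]
      linarith [hc.2]

/-- The distribution function of the virtual cost of a random seller. -/
noncomputable def virtualCostCDF (f : ℝ → ℝ) (t : ℝ) : ℝ :=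
  (costLaw f).real {c | 0 < f c ∧ virtualCost f c < t}

lemma virtualCostCDF_zero {f : ℝ → ℝ} (hf : IsCostDensity f) : virtualCostCDF f 0 = 0 := by
  have : {c | 0 < f c ∧ virtualCost f c < 0} = ∅ := by
    ext c
    simp only [mem_ofPred_eq, mem_empty_iff_false, iff_false, not_and, not_lt]
    exact fun h => (nonneg_of_density_pos hf h).trans (le_virtualCost hf c)
  simp [virtualCostCDF, this]

lemma tendsto_virtualCostCDF_div {f : ℝ → ℝ} (hf : IsCostDensity f)
    (hψ : StrictMonoOn (virtualCost f) {c | 0 ≤ c ∧ 0 < f c})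
    (hf_pos : ∃ c₁ > 0, ∀ c ∈ Icc (0 : ℝ) c₁, 0 < f c)
    (hf_cont : ContinuousWithinAt f (Ici 0) 0) :
    Tendsto (fun t => virtualCostCDF f t / t) (𝓝[>] 0) (𝓝 (f 0 / 2)) := by
  have := hf.isProbabilityMeasure
  have hlim : ∀ a : ℝ, 0 < a →
      Tendsto (fun t => costCDF f (a * t / 2) / t) (𝓝[>] 0) (𝓝 (f 0 * (a / 2))) := by
    intro a ha
    have h1 : Tendsto (fun t : ℝ => a * t / 2) (𝓝[>] 0) (𝓝[>] 0) := by
      refine tendsto_nhdsWithin_iff.2 ⟨?_, ?_⟩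
      · refine (Continuous.tendsto' (by fun_prop) 0 0 (by simp)).mono_left nhdsWithin_le_nhds
      · filter_upwards [self_mem_nhdsWithin] with t ht
        have : (0 : ℝ) < t := ht
        simp only [mem_Ioi]; positivity
    refine (((tendsto_costCDF_div hf hf_cont).comp h1).mul_const (a / 2)).congr' ?_
    filter_upwards [self_mem_nhdsWithin] with t ht
    have : t ≠ 0 := ne_of_gt ht
    simp only [Function.comp]
    field_simp
  have hIcc : ∀ d : ℝ, 0 ≤ d → costCDF f d = (costLaw f).real (Icc 0 d) := by
    intro d hd
    rw [costCDF]
    refine measureReal_congr ?_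
    filter_upwards [ae_costLaw_nonneg hf] with c hc
    exact propext ⟨fun h => ⟨hc, h⟩, fun h => h.2⟩
  have hsand : ∀ κ : ℝ, 0 < κ → κ < 1 → ∀ᶠ t in 𝓝[>] (0 : ℝ),
      costCDF f ((1 - κ) * t / 2) / t ≤ virtualCostCDF f t / t ∧
      virtualCostCDF f t / t ≤ costCDF f ((1 + κ) * t / 2) / t := by
    intro κ hκ hκ1
    filter_upwards [eventually_virtualCost_lt hf hψ hf_pos hf_cont hκ hκ1, self_mem_nhdsWithin]
      with t ⟨h1, h2⟩ ht
    have ht : 0 < t := ht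
    have hκ2 : 0 < 1 - κ := by linarith
    constructor
    · gcongr
      rw [hIcc _ (by positivity)]
      exact measureReal_mono h2
    · gcongr
      rw [hIcc _ (by positivity)]
      exact measureReal_mono fun c hc => ⟨nonneg_of_density_pos hf hc.1, h1 c hc.1 hc.2⟩
  have hf0 : 0 ≤ f 0 := hf.nonneg 0
  have hc1 : ContinuousWithinAt (fun κ : ℝ => f 0 * ((1 - κ) / 2)) (Ioi 0) 0 :=
    Continuous.continuousWithinAt (by fun_prop)
  have hc2 : ContinuousWithinAt (fun κ : ℝ => f 0 * ((1 + κ) / 2)) (Ioi 0) 0 :=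
    Continuous.continuousWithinAt (by fun_prop)
  have h01 : ∀ᶠ κ in 𝓝[>] (0 : ℝ), κ ∈ Ioo (0 : ℝ) 1 := Ioo_mem_nhdsGT one_pos
  refine tendsto_order.2 ⟨fun a ha => ?_, fun a ha => ?_⟩
  · obtain ⟨κ, hκ, hκ1⟩ := ((hc1.eventually_const_lt (u := a)
      (by simpa [div_eq_mul_inv] using ha)).and h01).exists
    filter_upwards [(hlim (1 - κ) (by linarith [hκ1.2])).eventually_const_lt hκ,
      hsand κ hκ1.1 hκ1.2] with t h1 h2
    linarith [h2.1]
  · obtain ⟨κ, hκ, hκ1⟩ := ((hc2.eventually_lt_const (u := a)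
      (by simpa [div_eq_mul_inv] using ha)).and h01).exists
    filter_upwards [(hlim (1 + κ) (by linarith [hκ1.1])).eventually_lt_const hκ,
      hsand κ hκ1.1 hκ1.2] with t h1 h2
    linarith [h2.2]

/-- The sellers of virtual cost below `t` are roughly those of sensitivity below `t / 2`. -/
lemma virtualCostDensity_zero {f : ℝ → ℝ} (hf : IsCostDensity f)
    (hψ : StrictMonoOn (virtualCost f) {c | 0 ≤ c ∧ 0 < f c})
    (hf_pos : ∃ c₁ > 0, ∀ c ∈ Icc (0 : ℝ) c₁, 0 < f c)
    (hf_cont : ContinuousWithinAt f (Ici 0) 0) :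
    virtualCostDensity f 0 = f 0 / 2 := by
  refine HasDerivWithinAt.derivWithin ?_ (uniqueDiffWithinAt_Ici 0)
  rw [hasDerivWithinAt_iff_tendsto_slope, Ici_sdiff_left]
  refine (tendsto_virtualCostCDF_div hf hψ hf_pos hf_cont).congr fun t => ?_
  have := virtualCostCDF_zero hf
  rw [slope_def_field]
  simp only [virtualCostCDF] at this ⊢
  rw [this]; simp


/-! ### Concentration inequalities -/

/-- The number of the first `N` samples that fall into `S`, as a real number. -/
noncomputable def hitCount {α : Type*} (N : ℕ) (S : Set α) (x : ℕ → α) : ℝ :=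
  ∑ i ∈ Finset.range N, S.indicator 1 (x i)

lemma hitCount_nonneg {α : Type*} (N : ℕ) (S : Set α) (x : ℕ → α) : 0 ≤ hitCount N S x :=
  Finset.sum_nonneg fun _ _ => indicator_nonneg (fun _ _ => zero_le_one) _

lemma hitCount_le {α : Type*} (N : ℕ) (S : Set α) (x : ℕ → α) : hitCount N S x ≤ N := by
  refine (Finset.sum_le_sum (g := fun _ => (1 : ℝ)) fun i _ => ?_).trans (by simp)
  exact indicator_le_self' (fun _ _ => zero_le_one) _

section Concentration

variable {Ω α E : Type*} [MeasurableSpace Ω] [MeasurableSpace α] [MeasurableSpace E]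
  {P : Measure Ω} [IsProbabilityMeasure P]

lemma measurable_hitCount (N : ℕ) {S : Set α} (hS : MeasurableSet S) :
    Measurable (hitCount N S) := by
  unfold hitCount
  exact Finset.measurable_fun_sum _ fun i _ =>
    (measurable_one.indicator hS).comp (measurable_pi_apply i)

lemma integrable_exp_mul_hitCount {N : ℕ} {S : Set α} (hS : MeasurableSet S) {c : ℕ → Ω → α}
    (hc : ∀ i, AEMeasurable (c i) P) (θ : ℝ) :
    Integrable (fun ω => Real.exp (θ * hitCount N S (fun i => c i ω))) P := by
  refine Integrable.of_bound (C := Real.exp (|θ| * N))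
    (((measurable_hitCount N hS).comp_aemeasurable
      (aemeasurable_pi_lambda _ hc)).const_mul θ).exp.aestronglyMeasurable (ae_of_all _ fun ω => ?_)
  rw [Real.norm_eq_abs, Real.abs_exp, Real.exp_le_exp]
  have h0 := hitCount_nonneg N S (fun i => c i ω)
  exact mul_le_mul (le_abs_self θ) (hitCount_le N S _) h0 (abs_nonneg θ)

/-- The moment generating function of a binomial count is at most that of the Poisson law with the
same mean. -/
lemma mgf_hitCount_le {ν : Measure α} {c : ℕ → Ω → α} (hc : ∀ i, HasLaw (c i) ν P)
    (hind : iIndepFun c P) {S : Set α} (hS : MeasurableSet S) (N : ℕ) (θ : ℝ) :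
    mgf (fun ω => hitCount N S (fun i => c i ω)) P θ ≤
      Real.exp (N * (ν.real S * (Real.exp θ - 1))) := by
  have hν : IsProbabilityMeasure ν := (hc 0).isProbabilityMeasure_iff.1 inferInstance
  have hmeas : Measurable (S.indicator (1 : α → ℝ)) := measurable_one.indicator hS
  have hone : ∀ i, mgf (fun ω => S.indicator (1 : α → ℝ) (c i ω)) P θ ≤
      Real.exp (ν.real S * (Real.exp θ - 1)) := by
    intro i
    have h1 : mgf (fun ω => S.indicator (1 : α → ℝ) (c i ω)) P θ
        = ∫ x, (1 + (Real.exp θ - 1) * S.indicator 1 x) ∂ν := by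
      rw [mgf, ← (hc i).integral_comp (f := fun x => 1 + (Real.exp θ - 1) * S.indicator 1 x)
        ((hmeas.const_mul _).const_add 1).aestronglyMeasurable]
      refine integral_congr_ae (ae_of_all _ fun ω => ?_)
      by_cases h : c i ω ∈ S <;> simp [h]
    have hint : Integrable (S.indicator (1 : α → ℝ)) ν := (integrable_const (1 : ℝ)).indicator hS
    rw [h1, integral_add (integrable_const _) (hint.const_mul _), integral_const_mul,
      integral_indicator_one hS]
    simp only [integral_const, probReal_univ, smul_eq_mul, mul_one]
    linarith [Real.add_one_le_exp (ν.real S * (Real.exp θ - 1))]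
  have hprod := (hind.comp (fun _ => S.indicator (1 : α → ℝ)) fun _ => hmeas).mgf_sum₀
    (t := θ) (fun i => hmeas.comp_aemeasurable (hc i).aemeasurable) (Finset.range N)
  have heq : (fun ω => hitCount N S (fun i => c i ω)) =
      ∑ i ∈ Finset.range N, S.indicator (1 : α → ℝ) ∘ c i := by
    ext ω; simp [hitCount]
  rw [heq, hprod, Real.exp_nat_mul]
  refine (Finset.prod_le_prod (fun i _ => mgf_nonneg) fun i _ => hone i).trans ?_
  simp

/-- Chernoff bound on the upper tail of a binomial count. -/
lemma measure_le_hitCount {ν : Measure α} {c : ℕ → Ω → α} (hc : ∀ i, HasLaw (c i) ν P)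
    (hind : iIndepFun c P) {S : Set α} (hS : MeasurableSet S) (N : ℕ) {θ : ℝ} (hθ : 0 ≤ θ)
    (k : ℝ) :
    P.real {ω | k ≤ hitCount N S (fun i => c i ω)} ≤
      Real.exp (N * (ν.real S * (Real.exp θ - 1)) - θ * k) := by
  refine (measure_ge_le_exp_mul_mgf k hθ
    (integrable_exp_mul_hitCount hS (fun i => (hc i).aemeasurable) θ)).trans ?_
  refine (mul_le_mul_of_nonneg_left (mgf_hitCount_le hc hind hS N θ) (Real.exp_pos _).le).trans ?_
  rw [← Real.exp_add, Real.exp_le_exp]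
  linarith

/-- Chernoff bound on the lower tail of a binomial count. -/
lemma measure_hitCount_le {ν : Measure α} {c : ℕ → Ω → α} (hc : ∀ i, HasLaw (c i) ν P)
    (hind : iIndepFun c P) {S : Set α} (hS : MeasurableSet S) (N : ℕ) {θ : ℝ} (hθ : 0 ≤ θ)
    (k : ℝ) :
    P.real {ω | hitCount N S (fun i => c i ω) ≤ k} ≤
      Real.exp (θ * k - N * (ν.real S * (1 - Real.exp (-θ)))) := by
  refine (measure_le_le_exp_mul_mgf k (neg_nonpos.2 hθ)
    (integrable_exp_mul_hitCount hS (fun i => (hc i).aemeasurable) (-θ))).trans ?_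
  refine (mul_le_mul_of_nonneg_left (mgf_hitCount_le hc hind hS N (-θ)) (Real.exp_pos _).le).trans ?_
  rw [← Real.exp_add, Real.exp_le_exp]
  linarith

/-- Hoeffding's inequality for a weighted average with deterministic weights in `[0, 1]`. The
exponent is linear in the total weight because `u i ^ 2 ≤ u i`. -/
lemma measure_weighted_deviation_le {𝒟 : Measure E} {Z : ℕ → Ω → E}
    (hZ : ∀ i, HasLaw (Z i) 𝒟 P) (hind : iIndepFun Z P) {g : E → ℝ} (hg : Measurable g)
    {B : ℝ} (hB : 0 < B) (hgB : ∀ᵐ z ∂𝒟, g z ∈ Icc 0 B) (N : ℕ) {u : ℕ → ℝ}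
    (hu : ∀ i, u i ∈ Icc (0 : ℝ) 1) {κ : ℝ} (hκ : 0 ≤ κ) :
    P.real {ω | 0 ≤ ∑ i ∈ Finset.range N, u i * (∫ z, g z ∂𝒟 - g (Z i ω) - κ)} ≤
      Real.exp (-(2 * κ ^ 2 / B ^ 2 * ∑ i ∈ Finset.range N, u i)) := by
  have hsub : ∀ i, HasSubgaussianMGF (fun ω => -u i * (g (Z i ω) - ∫ z, g z ∂𝒟))
      (‖u i‖₊ ^ 2 * (‖B - 0‖₊ / 2) ^ 2) P := by
    intro i
    have h1 := hasSubgaussianMGF_of_mem_Icc (μ := P) (X := fun ω => g (Z i ω)) (a := 0) (b := B)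
      (hg.comp_aemeasurable (hZ i).aemeasurable)
      (ae_of_ae_map (p := fun z => g z ∈ Icc 0 B) (hZ i).aemeasurable
        (by rw [(hZ i).map_eq]; exact hgB))
    have h2 : (∫ ω, g (Z i ω) ∂P) = ∫ z, g z ∂𝒟 :=
      (hZ i).integral_comp (f := g) hg.aestronglyMeasurable
    rw [h2] at h1
    convert h1.const_mul (-u i) using 2
    refine congrArg₂ (· * ·) (NNReal.eq ?_) rfl
    change ‖u i‖ ^ 2 = (-u i) ^ 2
    rw [Real.norm_eq_abs, sq_abs, neg_sq]
  have hind' : iIndepFun (fun i ω => -u i * (g (Z i ω) - ∫ z, g z ∂𝒟)) P :=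
    hind.comp (fun i z => -u i * (g z - ∫ z, g z ∂𝒟)) fun i => (hg.sub_const _).const_mul _
  set U := ∑ i ∈ Finset.range N, u i with hU
  have hU0 : 0 ≤ U := Finset.sum_nonneg fun i _ => (hu i).1
  have hmain := HasSubgaussianMGF.measure_sum_ge_le_of_iIndepFun hind' (s := Finset.range N)
    (fun i _ => hsub i) (ε := κ * U) (by positivity)
  have hset : {ω | 0 ≤ ∑ i ∈ Finset.range N, u i * (∫ z, g z ∂𝒟 - g (Z i ω) - κ)} =
      {ω | κ * U ≤ ∑ i ∈ Finset.range N, -u i * (g (Z i ω) - ∫ z, g z ∂𝒟)} := by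
    ext ω
    simp only [mem_ofPred_eq]
    have : ∑ i ∈ Finset.range N, u i * (∫ z, g z ∂𝒟 - g (Z i ω) - κ) =
        (∑ i ∈ Finset.range N, -u i * (g (Z i ω) - ∫ z, g z ∂𝒟)) - κ * U := by
      rw [hU, Finset.mul_sum, ← Finset.sum_sub_distrib]
      exact Finset.sum_congr rfl fun i _ => by ring
    rw [this, sub_nonneg]
  rw [hset]
  refine hmain.trans (Real.exp_le_exp.2 ?_)
  have hcoe : ((∑ i ∈ Finset.range N, (‖u i‖₊ ^ 2 * (‖B - 0‖₊ / 2) ^ 2 : NNReal) :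
      NNReal) : ℝ) = B ^ 2 / 4 * ∑ i ∈ Finset.range N, u i ^ 2 := by
    rw [NNReal.coe_sum, Finset.mul_sum]
    refine Finset.sum_congr rfl fun i _ => ?_
    rw [NNReal.coe_mul, NNReal.coe_pow, NNReal.coe_pow, NNReal.coe_div, coe_nnnorm, coe_nnnorm,
      sub_zero, Real.norm_eq_abs, Real.norm_eq_abs, abs_of_pos hB, sq_abs, NNReal.coe_ofNat]
    ring
  rw [hcoe]
  set V := ∑ i ∈ Finset.range N, u i ^ 2 with hV
  have hVU : V ≤ U := Finset.sum_le_sum fun i _ => by nlinarith [(hu i).1, (hu i).2]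
  have hV0 : 0 ≤ V := Finset.sum_nonneg fun i _ => sq_nonneg _
  rcases hV0.eq_or_lt with h | h
  · have hU' : U = 0 := by
      refine Finset.sum_eq_zero fun i hi => ?_
      have := (Finset.sum_eq_zero_iff_of_nonneg (fun i _ => sq_nonneg (u i))).1 h.symm i hi
      exact pow_eq_zero_iff two_ne_zero |>.1 this
    simp [hU']
  · rw [neg_div, neg_le_neg_iff, le_div_iff₀ (by positivity)]
    calc 2 * κ ^ 2 / B ^ 2 * U * (2 * (B ^ 2 / 4 * V)) = κ ^ 2 * U * V := by
          field_simp; ring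
      _ ≤ κ ^ 2 * U * U := by gcongr
      _ = (κ * U) ^ 2 := by ring

/-- Uniform law for weighted averages whose weights `u (c i)` are random but independent of the
samples `Z i`. Conditionally on the weights, Hoeffding's inequality gives a bound that is
exponential in the total weight, and the total weight is at least half the number of `i` with
`c i ∈ S`. -/
lemma measure_random_weighted_deviation_le {ν : Measure α} {c : ℕ → Ω → α}
    (hc : ∀ i, HasLaw (c i) ν P) (hcind : iIndepFun c P)
    {𝒟 : Measure E} {Z : ℕ → Ω → E} (hZ : ∀ i, HasLaw (Z i) 𝒟 P) (hZind : iIndepFun Z P)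
    (hcZ : IndepFun (fun ω i => c i ω) (fun ω i => Z i ω) P)
    {g : E → ℝ} (hg : Measurable g) {B : ℝ} (hB : 0 < B) (hgB : ∀ᵐ z ∂𝒟, g z ∈ Icc 0 B)
    (N : ℕ) {u : α → ℝ} (hum : Measurable u) (hu : ∀ x, u x ∈ Icc (0 : ℝ) 1)
    {S : Set α} (hS : MeasurableSet S) (huS : ∀ x ∈ S, 1 / 2 ≤ u x) {κ : ℝ} (hκ : 0 ≤ κ) :
    P.real {ω | 0 ≤ ∑ i ∈ Finset.range N, u (c i ω) * (∫ z, g z ∂𝒟 - g (Z i ω) - κ)} ≤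
      Real.exp (-(N * (ν.real S * (1 - Real.exp (-(κ ^ 2 / B ^ 2)))))) := by
  have hcm : AEMeasurable (fun ω i => c i ω) P :=
    aemeasurable_pi_lambda _ fun i => (hc i).aemeasurable
  have hZm : AEMeasurable (fun ω i => Z i ω) P :=
    aemeasurable_pi_lambda _ fun i => (hZ i).aemeasurable
  have : IsProbabilityMeasure (P.map fun ω i => Z i ω) := Measure.isProbabilityMeasure_map hZm
  set L := ∫ z, g z ∂𝒟 with hL
  set A : Set ((ℕ → α) × (ℕ → E)) :=
    {q | 0 ≤ ∑ i ∈ Finset.range N, u (q.1 i) * (L - g (q.2 i) - κ)} with hA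
  have hAm : MeasurableSet A := by
    refine measurableSet_le measurable_const (Finset.measurable_fun_sum _ fun i _ => ?_)
    refine (hum.comp ((measurable_pi_apply i).comp measurable_fst)).mul ?_
    exact ((hg.comp ((measurable_pi_apply i).comp measurable_snd)).const_sub L).sub_const κ
  have hPA : P {ω | 0 ≤ ∑ i ∈ Finset.range N, u (c i ω) * (L - g (Z i ω) - κ)} =
      ∫⁻ x, (P.map fun ω i => Z i ω) (Prod.mk x ⁻¹' A) ∂(P.map fun ω i => c i ω) := by
    rw [← Measure.prod_apply hAm, ← hcZ.map_prod_eq_prod_map_map hcm hZm,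
      Measure.map_apply_of_aemeasurable (hcm.prodMk hZm) hAm]
    rfl
  set θ := κ ^ 2 / B ^ 2 with hθ
  have hθ0 : 0 ≤ θ := by positivity
  have hfix : ∀ x : ℕ → α, (P.map fun ω i => Z i ω) (Prod.mk x ⁻¹' A) ≤
      ENNReal.ofReal (Real.exp (-θ * hitCount N S x)) := by
    intro x
    rw [Measure.map_apply_of_aemeasurable hZm (measurable_prodMk_left hAm),
      ← ofReal_measureReal (measure_ne_top _ _)]
    refine ENNReal.ofReal_le_ofReal ((measure_weighted_deviation_le hZ hZind hg hB hgB N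
      (u := fun i => u (x i)) (fun i => hu _) hκ).trans (Real.exp_le_exp.2 ?_))
    have hcount : hitCount N S x ≤ 2 * ∑ i ∈ Finset.range N, u (x i) := by
      rw [hitCount, Finset.mul_sum]
      refine Finset.sum_le_sum fun i _ => ?_
      by_cases h : x i ∈ S
      · simp only [indicator_of_mem h, Pi.one_apply]; linarith [huS _ h]
      · simp only [indicator_of_notMem h]; linarith [(hu (x i)).1]
    have h2 : 2 * κ ^ 2 / B ^ 2 = 2 * θ := by rw [hθ]; ring
    rw [h2]
    nlinarith [mul_le_mul_of_nonneg_left hcount hθ0]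
  have hbound : P {ω | 0 ≤ ∑ i ∈ Finset.range N, u (c i ω) * (L - g (Z i ω) - κ)} ≤
      ENNReal.ofReal (mgf (fun ω => hitCount N S (fun i => c i ω)) P (-θ)) := by
    rw [hPA]
    refine (lintegral_mono hfix).trans ?_
    rw [lintegral_map' (by
      exact ((measurable_hitCount N hS).const_mul (-θ)).exp.ennreal_ofReal.aemeasurable) hcm,
      mgf, ofReal_integral_eq_lintegral_ofReal
        (integrable_exp_mul_hitCount hS (fun i => (hc i).aemeasurable) (-θ))
        (ae_of_all _ fun ω => (Real.exp_pos _).le)]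
  refine (ENNReal.toReal_mono ENNReal.ofReal_ne_top hbound).trans ?_
  rw [ENNReal.toReal_ofReal mgf_nonneg]
  refine (mgf_hitCount_le hc hcind hS N (-θ)).trans (le_of_eq ?_)
  congr 1; ring

end Concentration

/-! ### The noise vector -/

lemma gammaPDFReal_one_eq (n : ℕ) (x : ℝ) :
    gammaPDFReal n 1 x = Real.exp (-(x / 2)) * (2 ^ n * gammaPDFReal n (1 / 2) x) := by
  unfold gammaPDFReal
  split_ifs with h
  · rw [Real.one_rpow, Real.rpow_natCast]
    have : Real.exp (-(1 * x)) = Real.exp (-(x / 2)) * Real.exp (-(1 / 2 * x)) := by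
      rw [← Real.exp_add]; ring_nf
    rw [this, one_div_pow]
    field_simp
  · simp

/-- The density of `Γ(n, 1)` is `2ⁿ e^{-x/2}` times that of `Γ(n, 1/2)`, which gives an exponential
tail bound. -/
lemma gammaMeasure_abs_ge_le {n : ℕ} (hn : 0 < n) (s : ℝ) :
    gammaMeasure n 1 {x | s ≤ |x|} ≤ ENNReal.ofReal (2 ^ n * Real.exp (-(s / 2))) := by
  have hm : MeasurableSet {x : ℝ | s ≤ |x|} := measurableSet_le measurable_const measurable_id.abs
  have hn' : (0 : ℝ) < n := by exact_mod_cast hn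
  rw [gammaMeasure, withDensity_apply _ hm]
  calc ∫⁻ x in {x : ℝ | s ≤ |x|}, gammaPDF n 1 x
      ≤ ∫⁻ x in {x : ℝ | s ≤ |x|},
          ENNReal.ofReal (2 ^ n * Real.exp (-(s / 2))) * gammaPDF n (1 / 2) x := by
        refine setLIntegral_mono' hm fun x hx => ?_
        rw [gammaPDF, gammaPDF, ← ENNReal.ofReal_mul (by positivity), gammaPDFReal_one_eq]
        refine ENNReal.ofReal_le_ofReal ?_
        rcases lt_or_ge x 0 with h | h
        · simp [gammaPDFReal, not_le.2 h]
        · have hx' : s ≤ x := by simpa [abs_of_nonneg h] using hx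
          have h0 := gammaPDFReal_nonneg hn' (r := 1 / 2) (by norm_num) x
          have h1 : Real.exp (-(x / 2)) ≤ Real.exp (-(s / 2)) := Real.exp_le_exp.2 (by linarith)
          rw [mul_comm (2 ^ n : ℝ) (Real.exp _), mul_assoc]
          gcongr
    _ ≤ ∫⁻ x, ENNReal.ofReal (2 ^ n * Real.exp (-(s / 2))) * gammaPDF n (1 / 2) x :=
        setLIntegral_le_lintegral _ _
    _ = ENNReal.ofReal (2 ^ n * Real.exp (-(s / 2))) := by
        rw [lintegral_const_mul' _ _ ENNReal.ofReal_ne_top,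
          lintegral_gammaPDF_eq_one hn' (by norm_num), mul_one]

lemma noiseLaw_norm_ge_le {n : ℕ} (hn : 0 < n) (s : ℝ) :
    noiseLaw n {b | s ≤ ‖b‖} ≤ ENNReal.ofReal (2 ^ n * Real.exp (-(s / 2))) := by
  have hn' : (0 : ℝ) < n := by exact_mod_cast hn
  have := isProbabilityMeasure_gammaMeasure hn' one_pos
  have hm : MeasurableSet {b : Feat n | s ≤ ‖b‖} := measurableSet_le measurable_const measurable_norm
  rw [noiseLaw, Measure.map_apply (by fun_prop) hm]
  have hset : (fun q : ℝ × Metric.sphere (0 : Feat n) 1 => q.1 • (q.2 : Feat n)) ⁻¹'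
      {b | s ≤ ‖b‖} = {x : ℝ | s ≤ |x|} ×ˢ univ := by
    ext q
    simp [norm_smul]
  rw [hset, Measure.prod_prod]
  refine (mul_le_of_le_one_right zero_le ?_).trans (gammaMeasure_abs_ge_le hn s)
  exact prob_le_one


/-! ### Privacy guarantees and payments -/

/-- The sensitivities of (finite) virtual cost below `t`. -/
def belowCost (f : ℝ → ℝ) (t : ℝ) : Set ℝ := {c | 0 < f c ∧ virtualCost f c < t}

open Classical in
/-- The guarantee `a (T - ψ(c))⁺`, which is linear in the virtual cost below the threshold `T`. -/
noncomputable def linearEps (f : ℝ → ℝ) (a T c : ℝ) : ℝ :=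
  if 0 < f c ∧ virtualCost f c < T then a * (T - virtualCost f c) else 0

lemma measurableSet_belowCost {f : ℝ → ℝ} (hf : IsCostDensity f) (t : ℝ) :
    MeasurableSet (belowCost f t) :=
  (measurableSet_lt measurable_const hf.measurable).inter
    (measurableSet_lt (measurable_virtualCost hf) measurable_const)

lemma measurable_linearEps {f : ℝ → ℝ} (hf : IsCostDensity f) (a T : ℝ) :
    Measurable (linearEps f a T) :=
  Measurable.ite (measurableSet_belowCost hf T)
    (((measurable_virtualCost hf).const_sub T).const_mul a) measurable_const

lemma linearEps_of_mem {f : ℝ → ℝ} {a T c : ℝ} (h : c ∈ belowCost f T) :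
    linearEps f a T c = a * (T - virtualCost f c) := if_pos h

lemma linearEps_of_notMem {f : ℝ → ℝ} {a T c : ℝ} (h : c ∉ belowCost f T) :
    linearEps f a T c = 0 := if_neg h

lemma linearEps_nonneg {f : ℝ → ℝ} {a : ℝ} (ha : 0 ≤ a) (T c : ℝ) : 0 ≤ linearEps f a T c := by
  by_cases h : c ∈ belowCost f T
  · rw [linearEps_of_mem h]
    exact mul_nonneg ha (sub_nonneg.2 h.2.le)
  · rw [linearEps_of_notMem h]

lemma linearEps_le {f : ℝ → ℝ} (hf : IsCostDensity f) {a T : ℝ} (ha : 0 ≤ a) (hT : 0 ≤ T)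
    (c : ℝ) : linearEps f a T c ≤ a * T := by
  by_cases h : c ∈ belowCost f T
  · rw [linearEps_of_mem h]
    have := (nonneg_of_density_pos hf h.1).trans (le_virtualCost hf c)
    gcongr
    linarith
  · rw [linearEps_of_notMem h]
    positivity

lemma half_le_linearEps {f : ℝ → ℝ} {a T c : ℝ} (ha : 0 ≤ a) (hT : 0 ≤ T)
    (hc : c ∈ belowCost f (T / 2)) : a * T / 2 ≤ linearEps f a T c := by
  have h2 : virtualCost f c < T / 2 := hc.2
  rw [linearEps_of_mem ⟨hc.1, by linarith⟩, mul_div_assoc]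
  gcongr
  linarith

/-- The guarantee is antitone once the density is positive on the whole range of sellers that
receive one: the threshold is crossed only once. -/
lemma antitoneOn_linearEps {f : ℝ → ℝ}
    (hψ : StrictMonoOn (virtualCost f) {c | 0 ≤ c ∧ 0 < f c}) {a T d : ℝ} (ha : 0 ≤ a)
    (hd : ∀ c ∈ belowCost f T, c ≤ d) (hpos : ∀ c ∈ Icc 0 d, 0 < f c) :
    AntitoneOn (linearEps f a T) (Ici 0) := by
  intro x hx y hy hxy
  by_cases h : y ∈ belowCost f T
  · have hfx : 0 < f x := hpos x ⟨hx, hxy.trans (hd y h)⟩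
    have hψxy := hψ.monotoneOn ⟨hx, hfx⟩ ⟨hy, h.1⟩ hxy
    have hxm : x ∈ belowCost f T := ⟨hfx, hψxy.trans_lt h.2⟩
    rw [linearEps_of_mem h, linearEps_of_mem hxm]
    gcongr
  · rw [linearEps_of_notMem h]
    exact linearEps_nonneg ha T x

lemma payment_eq_zero {eps : ℝ → ℝ} {c : ℝ} (h : ∀ z, c < z → eps z = 0) :
    payment eps c = 0 := by
  rw [payment, setIntegral_congr_fun (g := fun _ => 0) measurableSet_Ioi]
  · simp
  · intro z hz
    have : eps =ᶠ[𝓝 z] fun _ => 0 := by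
      filter_upwards [Ioi_mem_nhds hz] with x hx using h x hx
    simp [this.deriv_eq]

/-- The payment is an integral against the absolutely continuous part of the decrease of the
guarantee, which is at most its total decrease. -/
lemma payment_le {eps : ℝ → ℝ} (hanti : AntitoneOn eps (Ici 0)) (hnn : ∀ z, 0 ≤ eps z)
    {c d : ℝ} (hc : 0 ≤ c) (hcd : c ≤ d) (hd : ∀ z, d < z → eps z = 0) :
    payment eps c ≤ d * eps c := by
  have hd0 : 0 ≤ d := hc.trans hcd
  have hmono : MonotoneOn (fun z => -eps z) (uIcc c d) := by
    rw [uIcc_of_le hcd]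
    exact (hanti.mono fun z hz => hc.trans hz.1).neg
  have hint : IntegrableOn (deriv fun z => -eps z) (Ioo c d) := by
    have := hmono.intervalIntegrable_deriv
    rw [intervalIntegrable_iff_integrableOn_Ioo_of_le hcd] at this
    exact this
  have hle := hmono.intervalIntegral_deriv_mem_uIcc
  have hdle : -eps c ≤ -eps d := neg_le_neg (hanti hc hd0 hcd)
  rw [uIcc_of_le (by linarith), intervalIntegral.integral_of_le hcd,
    integral_Ioc_eq_integral_Ioo] at hle
  have hderiv : ∀ z, deriv (fun z => -eps z) z = -deriv eps z := fun z => deriv.fun_neg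
  -- beyond `d` the guarantee vanishes identically, so the integral stops at `d`
  have hzero : ∀ z ∈ Ioi d, z * deriv eps z = 0 := by
    intro z hz
    have : eps =ᶠ[𝓝 z] fun _ => 0 := by
      filter_upwards [Ioi_mem_nhds hz] with x hx using hd x hx
    simp [this.deriv_eq]
  have hneg : ∀ z ∈ Ioo c d, deriv eps z ≤ 0 := by
    intro z hz
    rw [← derivWithin_of_mem_nhds (Ici_mem_nhds (hc.trans_lt hz.1))]
    exact hanti.derivWithin_nonpos
  have hsplit : ∫ z in Ioi c, z * deriv eps z = ∫ z in Ioc c d, z * deriv eps z := by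
    refine setIntegral_eq_of_subset_of_forall_sdiff_eq_zero measurableSet_Ioi Ioc_subset_Ioi_self
      fun z hz => hzero z (not_le.1 fun h => hz.2 ⟨hz.1, h⟩)
  rw [payment, hsplit, integral_Ioc_eq_integral_Ioo, ← integral_neg]
  have hint' : IntegrableOn (fun z => -(z * deriv eps z)) (Ioo c d) := by
    refine (hint.norm.const_mul d).mono' ?_ ?_
    · refine (measurable_id.mul (measurable_deriv eps)).neg.aestronglyMeasurable
    · refine (ae_restrict_iff' measurableSet_Ioo).2 (ae_of_all _ fun z hz => ?_)
      rw [hderiv, norm_neg, norm_neg, norm_mul]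
      gcongr
      rw [Real.norm_eq_abs, abs_of_nonneg (hc.trans hz.1.le)]
      exact hz.2.le
  calc ∫ z in Ioo c d, -(z * deriv eps z)
      ≤ ∫ z in Ioo c d, d * deriv (fun z => -eps z) z := by
        refine setIntegral_mono_on hint' (hint.const_mul d) measurableSet_Ioo fun z hz => ?_
        rw [hderiv]
        nlinarith [hneg z hz, hz.2]
    _ = d * ∫ z in Ioo c d, deriv (fun z => -eps z) z := integral_const_mul _ _
    _ ≤ d * eps c := by
        gcongr
        linarith [hle.2, hnn d]

lemma payment_linearEps_le {f : ℝ → ℝ} (hf : IsCostDensity f)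
    (hψ : StrictMonoOn (virtualCost f) {c | 0 ≤ c ∧ 0 < f c}) {a T d : ℝ} (ha : 0 ≤ a)
    (hT : 0 ≤ T) (hd : ∀ c ∈ belowCost f T, c ≤ d) (hpos : ∀ c ∈ Icc 0 d, 0 < f c)
    {c : ℝ} (hc : 0 ≤ c) :
    payment (linearEps f a T) c ≤ d * (a * T) * (belowCost f T).indicator 1 c := by
  by_cases h : c ∈ belowCost f T
  · have hcd := hd c h
    rw [indicator_of_mem h, Pi.one_apply, mul_one]
    refine (payment_le (antitoneOn_linearEps hψ ha hd hpos) (linearEps_nonneg ha T) hc hcd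
      fun z hz => linearEps_of_notMem fun hz' => ?_).trans ?_
    · exact absurd (hd z hz') (not_le.2 hz)
    · gcongr
      · exact hc.trans hcd
      · exact linearEps_le hf ha hT c
  · rw [indicator_of_notMem h, mul_zero, payment_eq_zero]
    refine fun z hz => linearEps_of_notMem fun hz' => h ?_
    have hfc : 0 < f c := hpos c ⟨hc, hz.le.trans (hd z hz')⟩
    exact ⟨hfc, (hψ.monotoneOn ⟨hc, hfc⟩ ⟨hc.trans hz.le, hz'.1⟩ hz.le).trans_lt hz'.2⟩


/-! ### The logistic loss and the trained weights -/

lemma continuous_logisticLoss : Continuous logisticLoss := by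
  have h : ∀ s : ℝ, 1 + Real.exp (-s) ≠ 0 := fun s => by positivity
  unfold logisticLoss Real.logb
  exact (Continuous.log (by fun_prop) h).div_const _

lemma antitone_logisticLoss : Antitone logisticLoss := by
  intro s t hst
  refine Real.logb_le_logb_of_le one_lt_two (by positivity) ?_
  gcongr

lemma logisticLoss_nonneg (s : ℝ) : 0 ≤ logisticLoss s :=
  Real.logb_nonneg one_lt_two (by linarith [Real.exp_pos (-s)])

lemma one_le_logisticLoss {s : ℝ} (hs : s ≤ 0) : 1 ≤ logisticLoss s := by
  refine le_trans ?_ (antitone_logisticLoss hs)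
  norm_num [logisticLoss]

lemma logisticLoss_le_add (s t : ℝ) : logisticLoss s ≤ logisticLoss t + 2 * |s - t| := by
  have hlog2 : 1 / 2 < Real.log 2 := by linarith [Real.log_two_gt_d9]
  have h : Real.log (1 + Real.exp (-s)) ≤ |s - t| + Real.log (1 + Real.exp (-t)) := by
    rw [← Real.log_exp |s - t|, ← Real.log_mul (by positivity) (by positivity)]
    refine Real.log_le_log (by positivity) ?_
    rw [mul_add, ← Real.exp_add, mul_one]
    refine add_le_add (Real.one_le_exp (abs_nonneg _)) (Real.exp_le_exp.2 ?_)
    linarith [neg_abs_le (s - t)]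
  rw [logisticLoss, logisticLoss, Real.logb, Real.logb, div_add' _ _ _ (by linarith)]
  gcongr
  nlinarith [abs_nonneg (s - t)]

/-- The loss of the weights `w` on the data point `z`. -/
noncomputable def pointLoss {n : ℕ} (w : Feat n) (z : DataPoint n) : ℝ :=
  logisticLoss (z.2 * inner ℝ w z.1)

section

variable {n : ℕ}

/-- A normalized data point: features in the unit ball and label `±1`. -/
def IsNormalized (z : DataPoint n) : Prop := ‖z.1‖ ≤ 1 ∧ (z.2 = 1 ∨ z.2 = -1)

lemma IsNormalized.abs_label {z : DataPoint n} (hz : IsNormalized z) : |z.2| = 1 := by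
  rcases hz.2 with h | h <;> simp [h]

lemma IsNormalized.abs_margin_le {z : DataPoint n} (hz : IsNormalized z) (w : Feat n) :
    |z.2 * inner ℝ w z.1| ≤ ‖w‖ := by
  rw [abs_mul, hz.abs_label, one_mul]
  exact (abs_real_inner_le_norm w z.1).trans (mul_le_of_le_one_right (norm_nonneg _) hz.1)

lemma measurable_pointLoss (w : Feat n) : Measurable (pointLoss w) :=
  continuous_logisticLoss.measurable.comp
    (Continuous.measurable (by fun_prop : Continuous fun z : DataPoint n => z.2 * inner ℝ w z.1))

lemma pointLoss_mem_Icc {β : ℝ} {w : Feat n} (hw : ‖w‖ ≤ β) {z : DataPoint n}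
    (hz : IsNormalized z) : pointLoss w z ∈ Icc 0 (logisticLoss (-β)) :=
  ⟨logisticLoss_nonneg _, antitone_logisticLoss
    ((neg_le_neg hw).trans (neg_le_of_abs_le (hz.abs_margin_le w)))⟩

lemma pointLoss_le_add {w v : Feat n} {z : DataPoint n} (hz : IsNormalized z) :
    pointLoss w z ≤ pointLoss v z + 2 * ‖w - v‖ := by
  refine (logisticLoss_le_add _ (z.2 * inner ℝ v z.1)).trans ?_
  rw [← mul_sub, ← inner_sub_left]
  have := hz.abs_margin_le (w - v)
  unfold pointLoss
  linarith

variable (𝒟 : Measure (DataPoint n)) [IsProbabilityMeasure 𝒟]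

lemma integrable_pointLoss (h𝒟 : ∀ᵐ z ∂𝒟, IsNormalized z) (w : Feat n) :
    Integrable (pointLoss w) 𝒟 :=
  Integrable.of_mem_Icc 0 (logisticLoss (-‖w‖)) (measurable_pointLoss w).aemeasurable
    (h𝒟.mono fun _ hz => pointLoss_mem_Icc le_rfl hz)

/-- The logistic loss with logarithms to base `2` dominates the misclassification loss. -/
lemma testLoss_le_integral (h𝒟 : ∀ᵐ z ∂𝒟, IsNormalized z) (w : Feat n) :
    testLoss 𝒟 w ≤ ∫ z, pointLoss w z ∂𝒟 := by
  have h1 := mul_meas_ge_le_integral_of_nonneg (μ := 𝒟) (f := pointLoss w)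
    (ae_of_all _ fun z => logisticLoss_nonneg _) (integrable_pointLoss 𝒟 h𝒟 w) 1
  rw [one_mul] at h1
  refine le_trans ?_ h1
  refine ENNReal.toReal_mono (measure_ne_top _ _) (measure_mono_ae ?_)
  filter_upwards [h𝒟] with z hz hne
  refine one_le_logisticLoss (not_lt.1 fun hpos => hne ?_)
  rcases hz.2 with h | h
  · rw [h, one_mul] at hpos
    rw [h, Real.sign_of_pos hpos]
  · rw [h, neg_one_mul, neg_pos] at hpos
    rw [h, Real.sign_of_neg hpos]

lemma integral_pointLoss_le_add (h𝒟 : ∀ᵐ z ∂𝒟, IsNormalized z) (w v : Feat n) :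
    ∫ z, pointLoss w z ∂𝒟 ≤ ∫ z, pointLoss v z ∂𝒟 + 2 * ‖w - v‖ := by
  calc ∫ z, pointLoss w z ∂𝒟 ≤ ∫ z, (pointLoss v z + 2 * ‖w - v‖) ∂𝒟 :=
        integral_mono_ae (integrable_pointLoss 𝒟 h𝒟 w)
          ((integrable_pointLoss 𝒟 h𝒟 v).add (integrable_const _))
          (h𝒟.mono fun z hz => pointLoss_le_add hz)
    _ = _ := by
        rw [integral_add (integrable_pointLoss 𝒟 h𝒟 v) (integrable_const _)]
        simp

/-- The weighted training loss. -/
noncomputable def weightedLoss (N : ℕ) (eps : ℕ → ℝ) (z : ℕ → DataPoint n) (w : Feat n) : ℝ :=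
  ∑ i ∈ Finset.range N, eps i / totalEps N eps * pointLoss w (z i)

lemma sum_weights {N : ℕ} {eps : ℕ → ℝ} (hη : 0 < totalEps N eps) :
    ∑ i ∈ Finset.range N, eps i / totalEps N eps = 1 := by
  rw [← Finset.sum_div]
  exact div_self hη.ne'

lemma weightedLoss_le_add {N : ℕ} {eps : ℕ → ℝ} (heps : ∀ i, 0 ≤ eps i)
    (hη : 0 < totalEps N eps) {z : ℕ → DataPoint n} (hz : ∀ i, IsNormalized (z i))
    (w v : Feat n) :
    weightedLoss N eps z w ≤ weightedLoss N eps z v + 2 * ‖w - v‖ := by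
  have h : weightedLoss N eps z v + 2 * ‖w - v‖ =
      ∑ i ∈ Finset.range N, eps i / totalEps N eps * (pointLoss v (z i) + 2 * ‖w - v‖) := by
    simp_rw [mul_add]
    rw [Finset.sum_add_distrib, ← Finset.sum_mul, sum_weights hη, one_mul, weightedLoss]
  rw [h]
  refine Finset.sum_le_sum fun i _ => ?_
  exact mul_le_mul_of_nonneg_left (pointLoss_le_add (hz i)) (div_nonneg (heps i) hη.le)

/-- Comparison of the minimizer with the separating direction scaled to the same norm: the ridge
terms cancel, whatever the ridge parameter, and only the noise terms remain. -/
lemma weightedLoss_minimizer_le {N : ℕ} {eps : ℕ → ℝ} (heps : ∀ i, 0 ≤ eps i)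
    (hη : 0 < totalEps N eps) {z : ℕ → DataPoint n} {b w : Feat n} {Λ β ρ : ℝ} (hβ : 0 ≤ β)
    (hmin : IsMinOn (trainObjective N eps z b Λ) univ w) (hw : ‖w‖ = β)
    (hsep : ∃ v : Feat n, ‖v‖ = 1 ∧ ∀ i, ρ ≤ inner ℝ v (z i).1 * (z i).2) :
    weightedLoss N eps z w ≤ logisticLoss (ρ * β) + 4 * β * ‖b‖ / totalEps N eps := by
  obtain ⟨v, hv, hsep⟩ := hsep
  have hnorm : ‖β • v‖ = β := by rw [norm_smul, hv, mul_one, Real.norm_of_nonneg hβ]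
  have h := isMinOn_iff.1 hmin (β • v) (mem_univ _)
  simp only [trainObjective] at h
  rw [hw, hnorm] at h
  have h1 : ∑ i ∈ Finset.range N, eps i / totalEps N eps *
      logisticLoss ((z i).2 * inner ℝ (β • v) (z i).1) ≤ logisticLoss (ρ * β) := by
    rw [← one_mul (logisticLoss (ρ * β)), ← sum_weights hη, Finset.sum_mul]
    refine Finset.sum_le_sum fun i _ => ?_
    refine mul_le_mul_of_nonneg_left (antitone_logisticLoss ?_) (div_nonneg (heps i) hη.le)
    rw [real_inner_smul_left]
    nlinarith [mul_le_mul_of_nonneg_left (hsep i) hβ]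
  have hb : ∀ x : Feat n, ‖x‖ = β → |inner ℝ b x| ≤ ‖b‖ * β := fun x hx => by
    rw [← hx]; exact abs_real_inner_le_norm b x
  have h2 : 2 * inner ℝ b (β • v) / totalEps N eps - 2 * inner ℝ b w / totalEps N eps ≤
      4 * β * ‖b‖ / totalEps N eps := by
    rw [← sub_div]
    gcongr
    linarith [le_of_abs_le (hb _ hnorm), neg_le_of_abs_le (hb w hw)]
  simp only [weightedLoss, pointLoss]
  linarith

/-- If the weighted training losses are close to the expected losses on a finite net of the sphere
of radius `β`, then the test loss of a minimizer on this sphere is controlled. -/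
lemma testLoss_minimizer_le (h𝒟 : ∀ᵐ z ∂𝒟, IsNormalized z) {N : ℕ} {eps : ℕ → ℝ}
    (heps : ∀ i, 0 ≤ eps i) (hη : 0 < totalEps N eps) {z : ℕ → DataPoint n}
    (hz : ∀ i, IsNormalized (z i)) {b w : Feat n} {Λ β ρ κ : ℝ} (hβ : 0 ≤ β)
    (hmin : IsMinOn (trainObjective N eps z b Λ) univ w) (hw : ‖w‖ = β)
    (hsep : ∃ v : Feat n, ‖v‖ = 1 ∧ ∀ i, ρ ≤ inner ℝ v (z i).1 * (z i).2)
    {net : Set (Feat n)} (hnet : Metric.sphere 0 β ⊆ ⋃ v ∈ net, Metric.ball v κ)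
    (hdev : ∀ v ∈ net, ∑ i ∈ Finset.range N,
      eps i * (∫ x, pointLoss v x ∂𝒟 - pointLoss v (z i) - κ) < 0) :
    testLoss 𝒟 w ≤ logisticLoss (ρ * β) + 4 * β * ‖b‖ / totalEps N eps + 5 * κ := by
  obtain ⟨v, hv, hwv⟩ := mem_iUnion₂.1 (hnet (mem_sphere_zero_iff_norm.2 hw))
  rw [Metric.mem_ball, dist_eq_norm] at hwv
  have hd : ∫ x, pointLoss v x ∂𝒟 ≤ weightedLoss N eps z v + κ := by
    have h := hdev v hv
    have hsum : ∑ i ∈ Finset.range N,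
        eps i * (∫ x, pointLoss v x ∂𝒟 - pointLoss v (z i) - κ) =
        totalEps N eps * (∫ x, pointLoss v x ∂𝒟 - weightedLoss N eps z v - κ) := by
      have hw' : totalEps N eps * weightedLoss N eps z v =
          ∑ i ∈ Finset.range N, eps i * pointLoss v (z i) := by
        rw [weightedLoss, Finset.mul_sum]
        refine Finset.sum_congr rfl fun i _ => ?_
        field_simp
      rw [mul_sub, mul_sub, hw']
      simp_rw [mul_sub]
      rw [Finset.sum_sub_distrib, Finset.sum_sub_distrib, ← Finset.sum_mul, ← Finset.sum_mul]
      rfl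
    rw [hsum] at h
    have := (pos_iff_neg_of_mul_neg h).1 hη
    linarith
  have h1 := testLoss_le_integral 𝒟 h𝒟 w
  have h2 := integral_pointLoss_le_add 𝒟 h𝒟 w v
  have h3 := weightedLoss_le_add heps hη hz v w
  have h4 := weightedLoss_minimizer_le heps hη hβ hmin hw hsep
  rw [norm_sub_rev] at h3
  linarith

end


/-! ### The failure probability for a fixed market size -/

/-- Non-asymptotic form of the theorem for the guarantees `a (T - ψ(c))⁺`. The number `s` is the
scale of the expected number of sellers with a positive guarantee. Outside four exceptional events
(too many paid sellers, too small a total guarantee, too much noise, weighted training loss more than `κ` below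
the expected loss at a point of the net) the excess of the objective is less than `X`. -/
lemma failure_probability_le
    {Ω : Type*} [MeasurableSpace Ω] {P : Measure Ω} [IsProbabilityMeasure P] {n : ℕ}
    {f : ℝ → ℝ} (hf : IsCostDensity f)
    (hψ : StrictMonoOn (virtualCost f) {c | 0 ≤ c ∧ 0 < f c})
    {𝒟 : Measure (DataPoint n)} [IsProbabilityMeasure 𝒟] (h𝒟 : ∀ᵐ z ∂𝒟, IsNormalized z)
    {c : ℕ → Ω → ℝ} {Z : ℕ → Ω → DataPoint n} {b : Ω → Feat n}
    (hc_law : ∀ i, HasLaw (c i) (costLaw f) P) (hc_indep : iIndepFun c P)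
    (hZ_law : ∀ i, HasLaw (Z i) 𝒟 P) (hZ_indep : iIndepFun Z P)
    (hcZ : IndepFun (fun ω i => c i ω) (fun ω i => Z i ω) P)
    (hb_law : HasLaw b (noiseLaw n) P) {ρ : ℝ}
    (hsep : ∀ᵐ ω ∂P, ∃ w : Feat n, ‖w‖ = 1 ∧ ∀ i, ρ ≤ inner ℝ w (Z i ω).1 * (Z i ω).2)
    {β γ : ℝ} (hβ : 0 < β) (hγ : 0 < γ) {a T d s κ r X : ℝ} (N : ℕ) (ha : 0 < a) (hT : 0 < T)
    (hd0 : 0 ≤ d) (hd : ∀ c ∈ belowCost f T, c ≤ d) (hpos : ∀ c ∈ Icc 0 d, 0 < f c)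
    (hs : 0 < s) (hκ : 0 ≤ κ)
    (hq : N * (costLaw f).real (belowCost f T) ≤ 11 / 10 * s)
    (hq' : s / 5 ≤ N * (costLaw f).real (belowCost f (T / 2)))
    {net : Finset (Feat n)} (hnet_norm : ∀ v ∈ net, ‖v‖ ≤ β)
    (hnet : Metric.sphere 0 β ⊆ ⋃ v ∈ (net : Set (Feat n)), Metric.ball v κ)
    (hX : γ * (d * (a * T) * (13 / 10 * s)) + 4 * β * r / (a * T * s / 40) + 5 * κ < X)
    (w : Ω → Feat n) :
    P.real {ω |
        (∃ Λ : ℝ, 0 < Λ ∧ IsMinOn (trainObjective N (fun i => linearEps f a T (c i ω))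
          (fun i => Z i ω) (b ω) Λ) univ (w ω)) ∧
        ‖w ω‖ = β ∧
        logisticLoss (ρ * β) + X ≤
          buyerObjective 𝒟 γ N (w ω) (fun i => payment (linearEps f a T) (c i ω))} ≤
      Real.exp (-(9 / 1000 * s)) + Real.exp (-(1 / 20 * s)) + 2 ^ n * Real.exp (-(r / 2)) +
        net.card * Real.exp
          (-((1 - Real.exp (-(κ ^ 2 / logisticLoss (-β) ^ 2))) / 5 * s)) := by
  have hh : 0 < a * T := mul_pos ha hT
  have hB : 0 < logisticLoss (-β) :=
    one_pos.trans_le (one_le_logisticLoss (neg_nonpos.2 hβ.le))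
  set dev : Feat n → Set Ω := fun v => {ω | 0 ≤ ∑ i ∈ Finset.range N,
    linearEps f a T (c i ω) / (a * T) *
      (∫ x, pointLoss v x ∂𝒟 - pointLoss v (Z i ω) - κ)} with hdev
  set E₁ : Set Ω := {ω | 13 / 10 * s ≤ hitCount N (belowCost f T) (fun i => c i ω)} with hE₁
  set E₂ : Set Ω := {ω | hitCount N (belowCost f (T / 2)) (fun i => c i ω) ≤ s / 20} with hE₂
  set E₃ : Set Ω := {ω | r ≤ ‖b ω‖} with hE₃
  set E₄ : Set Ω := ⋃ v ∈ net, dev v with hE₄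
  -- the tilt `θ = 1 / 10` is small enough for `13 / 10 θ > 11 / 10 (exp θ - 1)`
  have hP₁ : P.real E₁ ≤ Real.exp (-(9 / 1000 * s)) := by
    refine (measure_le_hitCount hc_law hc_indep (measurableSet_belowCost hf T) N
      (θ := 1 / 10) (by norm_num) _).trans (Real.exp_le_exp.2 ?_)
    have he : Real.exp (1 / 10) - 1 ≤ 11 / 100 := by
      have := Real.abs_exp_sub_one_sub_id_le (x := 1 / 10) (by norm_num [abs_le])
      have := le_of_abs_le this
      norm_num at this ⊢
      linarith
    have he0 : 0 ≤ Real.exp (1 / 10) - 1 := by linarith [Real.add_one_le_exp (1 / 10 : ℝ)]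
    calc _ = N * (costLaw f).real (belowCost f T) * (Real.exp (1 / 10) - 1)
          - 1 / 10 * (13 / 10 * s) := by ring
      _ ≤ 11 / 10 * s * (11 / 100) - 1 / 10 * (13 / 10 * s) := by gcongr
      _ = _ := by ring
  have hP₂ : P.real E₂ ≤ Real.exp (-(1 / 20 * s)) := by
    refine (measure_hitCount_le hc_law hc_indep (measurableSet_belowCost hf (T / 2)) N
      (θ := 1) zero_le_one _).trans (Real.exp_le_exp.2 ?_)
    have he : 1 / 2 ≤ 1 - Real.exp (-1) := by
      rw [Real.exp_neg]
      have : (Real.exp 1)⁻¹ ≤ 2⁻¹ := by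
        gcongr
        linarith [Real.add_one_le_exp (1 : ℝ)]
      linarith
    calc _ = 1 * (s / 20) - N * (costLaw f).real (belowCost f (T / 2)) * (1 - Real.exp (-1)) := by
          ring
      _ ≤ 1 * (s / 20) - s / 5 * (1 / 2) := by gcongr
      _ = _ := by ring
  have hP₃ : P.real E₃ ≤ 2 ^ n * Real.exp (-(r / 2)) := by
    -- in dimension `0` there is no unit vector, hence no separating direction
    have hn : 0 < n := by
      obtain ⟨ω, v, hv, -⟩ := hsep.exists
      rcases Nat.eq_zero_or_pos n with rfl | h
      · have : v = 0 := Subsingleton.elim _ _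
        simp [this] at hv
      · exact h
    have h := hb_law.measure_eq (p := fun x => r ≤ ‖x‖)
      (measurableSet_le measurable_const measurable_norm)
    refine (ENNReal.toReal_mono ENNReal.ofReal_ne_top
      (h.trans_le (noiseLaw_norm_ge_le hn r))).trans ?_
    rw [ENNReal.toReal_ofReal (by positivity)]
  have hP₄ : P.real E₄ ≤ net.card * Real.exp
      (-((1 - Real.exp (-(κ ^ 2 / logisticLoss (-β) ^ 2))) / 5 * s)) := by
    refine (measureReal_biUnion_finset_le net dev).trans ?_
    rw [← nsmul_eq_mul]
    refine Finset.sum_le_card_nsmul _ _ _ fun v hv => ?_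
    refine (measure_random_weighted_deviation_le hc_law hc_indep hZ_law hZ_indep hcZ
      (measurable_pointLoss v) hB (h𝒟.mono fun z hz => pointLoss_mem_Icc (hnet_norm v hv) hz) N
      ((measurable_linearEps hf a T).div_const (a * T)) (fun x => ?_)
      (measurableSet_belowCost hf (T / 2)) (fun x hx => ?_) hκ).trans (Real.exp_le_exp.2 ?_)
    · exact ⟨div_nonneg (linearEps_nonneg ha.le T x) hh.le,
        (div_le_one hh).2 (linearEps_le hf ha.le hT.le x)⟩
    · rw [le_div_iff₀ hh]
      linarith [half_le_linearEps ha.le hT.le hx]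
    · have he : 0 ≤ 1 - Real.exp (-(κ ^ 2 / logisticLoss (-β) ^ 2)) := by
        rw [sub_nonneg, Real.exp_le_one_iff]
        exact neg_nonpos.2 (by positivity)
      rw [neg_le_neg_iff]
      calc _ = s / 5 * (1 - Real.exp (-(κ ^ 2 / logisticLoss (-β) ^ 2))) := by ring
        _ ≤ N * (costLaw f).real (belowCost f (T / 2)) *
            (1 - Real.exp (-(κ ^ 2 / logisticLoss (-β) ^ 2))) := by gcongr
        _ = _ := by ring
  have hcnn : ∀ᵐ ω ∂P, ∀ i, 0 ≤ c i ω := ae_all_iff.2 fun i =>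
    ae_of_ae_map (p := fun x => 0 ≤ x) (hc_law i).aemeasurable
      (by rw [(hc_law i).map_eq]; exact ae_costLaw_nonneg hf)
  have hZn : ∀ᵐ ω ∂P, ∀ i, IsNormalized (Z i ω) := ae_all_iff.2 fun i =>
    ae_of_ae_map (p := IsNormalized) (hZ_law i).aemeasurable (by rw [(hZ_law i).map_eq]; exact h𝒟)
  have hsub : P.real (E₁ ∪ E₂ ∪ E₃ ∪ E₄) ≤
      P.real E₁ + P.real E₂ + P.real E₃ + P.real E₄ := by
    refine (measureReal_union_le _ _).trans ?_
    gcongr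
    refine (measureReal_union_le _ _).trans ?_
    gcongr
    exact measureReal_union_le _ _
  refine le_trans (ENNReal.toReal_mono (measure_ne_top _ _) (measure_mono_ae ?_))
    (hsub.trans (by gcongr))
  filter_upwards [hsep, hcnn, hZn] with ω hsepω hcω hZω hbad
  by_contra hgood
  obtain ⟨⟨Λ, -, hmin⟩, hw, hobj⟩ := hbad
  have hgood' : ω ∉ E₁ ∪ E₂ ∪ E₃ ∪ E₄ := hgood
  simp only [mem_union, not_or] at hgood'
  obtain ⟨⟨⟨h₁, h₂⟩, h₃⟩, h₄⟩ := hgood'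
  have h₁ : hitCount N (belowCost f T) (fun i => c i ω) < 13 / 10 * s := not_le.1 h₁
  have h₂ : s / 20 < hitCount N (belowCost f (T / 2)) (fun i => c i ω) := not_le.1 h₂
  have h₃ : ‖b ω‖ < r := not_le.1 h₃
  set eps : ℕ → ℝ := fun i => linearEps f a T (c i ω) with heps
  have heps0 : ∀ i, 0 ≤ eps i := fun i => linearEps_nonneg ha.le T _
  have hη : a * T * s / 40 ≤ totalEps N eps := by
    have h : a * T / 2 * hitCount N (belowCost f (T / 2)) (fun i => c i ω) ≤ totalEps N eps := by
      rw [hitCount, Finset.mul_sum, totalEps]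
      refine Finset.sum_le_sum fun i _ => ?_
      by_cases hi : c i ω ∈ belowCost f (T / 2)
      · rw [indicator_of_mem hi, Pi.one_apply, mul_one]
        exact half_le_linearEps ha.le hT.le hi
      · rw [indicator_of_notMem hi, mul_zero]
        exact heps0 i
    refine le_trans ?_ h
    calc a * T * s / 40 = a * T / 2 * (s / 20) := by ring
      _ ≤ _ := by gcongr
  have hη0 : 0 < totalEps N eps := lt_of_lt_of_le (by positivity) hη
  have hdev' : ∀ v ∈ (net : Set (Feat n)), ∑ i ∈ Finset.range N,
      eps i * (∫ x, pointLoss v x ∂𝒟 - pointLoss v (Z i ω) - κ) < 0 := by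
    intro v hv
    have h := fun h => h₄ (mem_biUnion (x := v) hv h)
    have h : ∑ i ∈ Finset.range N, eps i / (a * T) *
        (∫ x, pointLoss v x ∂𝒟 - pointLoss v (Z i ω) - κ) < 0 := not_le.1 h
    have heq : ∑ i ∈ Finset.range N, eps i * (∫ x, pointLoss v x ∂𝒟 - pointLoss v (Z i ω) - κ) =
        a * T * ∑ i ∈ Finset.range N, eps i / (a * T) *
          (∫ x, pointLoss v x ∂𝒟 - pointLoss v (Z i ω) - κ) := by
      rw [Finset.mul_sum]
      refine Finset.sum_congr rfl fun i _ => ?_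
      rw [← mul_assoc, mul_div_cancel₀ _ hh.ne']
    rw [heq]
    exact mul_neg_of_pos_of_neg hh h
  have htest := testLoss_minimizer_le 𝒟 h𝒟 heps0 hη0 hZω hβ.le hmin hw hsepω hnet hdev'
  have hpay : ∑ i ∈ Finset.range N, payment (linearEps f a T) (c i ω) ≤
      d * (a * T) * (13 / 10 * s) := by
    calc ∑ i ∈ Finset.range N, payment (linearEps f a T) (c i ω)
        ≤ ∑ i ∈ Finset.range N, d * (a * T) * (belowCost f T).indicator 1 (c i ω) :=
          Finset.sum_le_sum fun i _ =>
            payment_linearEps_le hf hψ ha.le hT.le hd hpos (hcω i)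
      _ = d * (a * T) * hitCount N (belowCost f T) (fun i => c i ω) := by
          rw [hitCount, Finset.mul_sum]
      _ ≤ _ := by gcongr
  have hnoise : 4 * β * ‖b ω‖ / totalEps N eps ≤ 4 * β * r / (a * T * s / 40) := by
    have := (norm_nonneg (b ω)).trans h₃.le
    gcongr
  have := mul_le_mul_of_nonneg_left hpay hγ.le
  simp only [buyerObjective] at hobj
  linarith


/-! ### Asymptotics of the hyperparameters -/

/-- The threshold `λ / γ` for the virtual cost, when `σ = μ²`. -/
noncomputable def costThreshold (γ p : ℝ) (m : ℕ) : ℝ := (√(γ * m * p))⁻¹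

/-- The largest guarantee that is offered, when `σ = μ²`. -/
noncomputable def maxEps (γ p μ : ℝ) (m : ℕ) : ℝ :=
  2 * √3 * μ * γ ^ (1 / 4 : ℝ) / ((m : ℝ) ^ (1 / 4 : ℝ) * p ^ (1 / 4 : ℝ))

lemma rpow_quarter_pow_four {x : ℝ} (hx : 0 ≤ x) : (x ^ (1 / 4 : ℝ)) ^ 4 = x := by
  rw [← Real.rpow_natCast, ← Real.rpow_mul hx]
  norm_num

lemma pow_four_rpow {x : ℝ} (hx : 0 ≤ x) (k : ℕ) (e : ℝ) (he : 4 * e = k) :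
    (x ^ 4) ^ e = x ^ k := by
  rw [← Real.rpow_natCast x 4, ← Real.rpow_mul hx, ← Real.rpow_natCast x k]
  congr 1

lemma pow_two_rpow {x : ℝ} (hx : 0 ≤ x) (k : ℕ) (e : ℝ) (he : 2 * e = k) :
    (x ^ 2) ^ e = x ^ k := by
  rw [← Real.rpow_natCast x 2, ← Real.rpow_mul hx, ← Real.rpow_natCast x k]
  congr 1

lemma costThreshold_pos {γ p : ℝ} (hγ : 0 < γ) (hp : 0 < p) {m : ℕ} (hm : 0 < m) :
    0 < costThreshold γ p m := by
  have : (0 : ℝ) < m := by exact_mod_cast hm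
  unfold costThreshold
  positivity

lemma costThreshold_eq {γ p : ℝ} (hγ : 0 < γ) (hp : 0 < p) (m : ℕ) :
    costThreshold γ p m =
      ((γ ^ (1 / 4 : ℝ)) ^ 2 * ((m : ℝ) ^ (1 / 4 : ℝ)) ^ 2 * (p ^ (1 / 4 : ℝ)) ^ 2)⁻¹ := by
  have hm : (0 : ℝ) ≤ m := m.cast_nonneg
  rw [costThreshold]
  congr 1
  rw [Real.sqrt_eq_iff_mul_self_eq (by positivity) (by positivity)]
  calc γ * m * p
      = (γ ^ (1 / 4 : ℝ)) ^ 4 * ((m : ℝ) ^ (1 / 4 : ℝ)) ^ 4 * (p ^ (1 / 4 : ℝ)) ^ 4 := by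
        rw [rpow_quarter_pow_four hγ.le, rpow_quarter_pow_four hm, rpow_quarter_pow_four hp.le]
    _ = _ := by ring

lemma cutoff_eq {γ p μ : ℝ} (hγ : 0 < γ) (hμ : μ ≠ 0) (m : ℕ) :
    cutoff μ (μ ^ 2) γ p m = γ * costThreshold γ p m := by
  have h1 : μ ^ 2 * γ / (μ ^ 2 * m * p) = γ ^ 2 / (γ * m * p) := by
    have : γ * m * p = γ * (m * p) := by ring
    rw [mul_assoc (μ ^ 2), mul_div_mul_left _ _ (pow_ne_zero 2 hμ), this, sq,
      mul_div_mul_left _ _ hγ.ne']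
  rw [cutoff, h1, Real.sqrt_div (sq_nonneg γ), Real.sqrt_sq hγ.le, costThreshold, div_eq_mul_inv]

/-- When `σ = μ²`, the online guarantee is linear in the virtual cost, with threshold
`costThreshold` and maximal value `maxEps`. -/
lemma onlineEps_eq_linearEps {f : ℝ → ℝ} {γ p μ : ℝ} (hγ : 0 < γ) (hμ : μ ≠ 0)
    (hpf : virtualCostDensity f 0 = p) (hp : 0 < p) {m : ℕ} (hm : 0 < m) :
    onlineEps f μ (μ ^ 2) γ m =
      linearEps f (maxEps γ p μ m / costThreshold γ p m) (costThreshold γ p m) := by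
  have hm' : (0 : ℝ) < m := by exact_mod_cast hm
  ext c
  have hcond : γ * virtualCost f c < γ * costThreshold γ p m ↔
      virtualCost f c < costThreshold γ p m := mul_lt_mul_iff_right₀ hγ
  simp only [onlineEps, linearEps, hpf, cutoff_eq hγ hμ, hcond]
  refine if_congr Iff.rfl ?_ rfl
  rw [costThreshold_eq hγ hp, maxEps, ← mul_sub]
  obtain ⟨G, hG, hG4⟩ : ∃ G, 0 < G ∧ γ ^ (1 / 4 : ℝ) = G := ⟨_, by positivity, rfl⟩
  obtain ⟨M, hM, hM4⟩ : ∃ M, 0 < M ∧ (m : ℝ) ^ (1 / 4 : ℝ) = M := ⟨_, by positivity, rfl⟩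
  obtain ⟨Q, hQ, hQ4⟩ : ∃ Q, 0 < Q ∧ p ^ (1 / 4 : ℝ) = Q := ⟨_, by positivity, rfl⟩
  have hγG : γ = G ^ 4 := by rw [← hG4, rpow_quarter_pow_four hγ.le]
  have hmM : (m : ℝ) = M ^ 4 := by rw [← hM4, rpow_quarter_pow_four hm'.le]
  have hpQ : p = Q ^ 4 := by rw [← hQ4, rpow_quarter_pow_four hp.le]
  rw [hG4, hM4, hQ4, hγG, hmM, hpQ, pow_four_rpow hG.le 6 _ (by norm_num),
    pow_four_rpow hM.le 6 _ (by norm_num), pow_four_rpow hQ.le 6 _ (by norm_num)]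
  have hlam : G ^ 4 * (G ^ 2 * M ^ 2 * Q ^ 2)⁻¹ = (G / (M * Q)) ^ 2 := by
    field_simp
  rw [hlam, pow_two_rpow (by positivity) 7 _ (by norm_num)]
  field_simp

lemma muParam_eq {E γ β ν δ : ℝ} (hE : 0 < E) (hγ : 0 < γ) (m : ℕ)
    (hδ : δ = Real.exp (-(deltaRate E γ β * ν * (m : ℝ) ^ (1 / 4 : ℝ)))) :
    muParam δ β = √3 * ν * (m : ℝ) ^ (1 / 4 : ℝ) / (E * γ ^ (1 / 4 : ℝ)) + β / Real.log 2 := by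
  have hL : 0 < Real.logb 2 (1 + Real.exp β) :=
    Real.logb_pos one_lt_two (by linarith [Real.exp_pos β])
  have hG : 0 < γ ^ (1 / 4 : ℝ) := by positivity
  rw [muParam, hδ, one_div, ← Real.exp_neg, neg_neg, Real.log_exp, deltaRate]
  congr 1
  field_simp
  rw [Real.sq_sqrt (by norm_num)]

lemma tendsto_rpow_quarter : Tendsto (fun m : ℕ => (m : ℝ) ^ (1 / 4 : ℝ)) atTop atTop :=
  (tendsto_rpow_atTop (by norm_num)).comp tendsto_natCast_atTop_atTop

lemma proxyConst_mul {ξ p : ℝ} (hξ : 0 < ξ) (hp : 0 < p) :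
    proxyConst ξ p * p ^ (1 / 4 : ℝ) = 2 / √ξ + 1 / ξ + 3 * ξ := by
  obtain ⟨Q, hQ, hQ4⟩ : ∃ Q, 0 < Q ∧ p ^ (1 / 4 : ℝ) = Q := ⟨_, by positivity, rfl⟩
  have hpQ : p = Q ^ 4 := by rw [← hQ4, rpow_quarter_pow_four hp.le]
  have h1 : p ^ (1 / 2 : ℝ) = Q ^ 2 := by rw [hpQ, pow_four_rpow hQ.le 2 _ (by norm_num)]
  have h3 : p ^ (3 / 4 : ℝ) = Q ^ 3 := by rw [hpQ, pow_four_rpow hQ.le 3 _ (by norm_num)]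
  have h5 : p ^ (5 / 4 : ℝ) = Q ^ 5 := by rw [hpQ, pow_four_rpow hQ.le 5 _ (by norm_num)]
  have hr : 0 < √ξ := Real.sqrt_pos.2 hξ
  rw [proxyConst, h1, h3, h5, hQ4, hpQ, ← Real.sqrt_eq_rpow]
  field_simp

/-- The maximal guarantee stays bounded: its limit is `6 ν / (p^{1/4} E)`. -/
lemma tendsto_maxEps {γ p β ν E₀ : ℝ} (hγ : 0 < γ) (hp : 0 < p) (hE₀ : 0 < E₀)
    {E δ μ : ℕ → ℝ} (hE : Tendsto E atTop (𝓝 E₀))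
    (hδ : ∀ m, δ m = Real.exp (-(deltaRate (E m) γ β * ν * (m : ℝ) ^ (1 / 4 : ℝ))))
    (hμ : ∀ m, μ m = muParam (δ m) β) :
    Tendsto (fun m => maxEps γ p (μ m) m) atTop (𝓝 (6 * ν / (E₀ * p ^ (1 / 4 : ℝ)))) := by
  have hQ : 0 < p ^ (1 / 4 : ℝ) := by positivity
  have hG : 0 < γ ^ (1 / 4 : ℝ) := by positivity
  have h1 : Tendsto (fun m => 6 * ν / (E m * p ^ (1 / 4 : ℝ))) atTop
      (𝓝 (6 * ν / (E₀ * p ^ (1 / 4 : ℝ)))) :=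
    (tendsto_const_nhds).div (hE.mul_const _) (by positivity)
  have h2 : Tendsto (fun m : ℕ => 2 * √3 * (β / Real.log 2) * γ ^ (1 / 4 : ℝ) / p ^ (1 / 4 : ℝ) /
      (m : ℝ) ^ (1 / 4 : ℝ)) atTop (𝓝 0) := tendsto_rpow_quarter.const_div_atTop _
  have h := h1.add h2
  rw [add_zero] at h
  refine h.congr' ?_
  filter_upwards [hE.eventually_const_lt hE₀, eventually_gt_atTop 0] with m hEm hm
  have hm' : (0 : ℝ) < m := by exact_mod_cast hm
  have hM : 0 < (m : ℝ) ^ (1 / 4 : ℝ) := by positivity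
  have h3 : √3 * √3 = 3 := Real.mul_self_sqrt (by norm_num)
  have hlog : 0 < Real.log 2 := Real.log_pos one_lt_two
  rw [hμ, muParam_eq hEm hγ m (hδ m), maxEps]
  field_simp
  linear_combination (-2 * ν * (m : ℝ) ^ (1 / 4 : ℝ) * Real.log 2) * h3

lemma tendsto_costThreshold {γ p : ℝ} (hγ : 0 < γ) (hp : 0 < p) :
    Tendsto (costThreshold γ p) atTop (𝓝[>] 0) := by
  refine tendsto_nhdsWithin_iff.2 ⟨?_, ?_⟩
  · refine Tendsto.inv_tendsto_atTop (Real.tendsto_sqrt_atTop.comp ?_)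
    exact (tendsto_natCast_atTop_atTop.const_mul_atTop hγ).atTop_mul_const hp
  · filter_upwards [eventually_gt_atTop 0] with m hm using costThreshold_pos hγ hp hm

lemma isBigO_exp_neg_sq {k : ℝ} (hk : 0 < k) (D : ℝ) :
    (fun m : ℕ => Real.exp (-(k * ((m : ℝ) ^ (1 / 4 : ℝ)) ^ 2))) =O[atTop]
      fun m : ℕ => Real.exp (-(D * (m : ℝ) ^ (1 / 4 : ℝ))) := by
  refine IsBigO.of_bound' ?_
  filter_upwards [tendsto_rpow_quarter.eventually_ge_atTop (D / k),
    tendsto_rpow_quarter.eventually_ge_atTop 0] with m hm h0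
  rw [Real.norm_eq_abs, Real.norm_eq_abs, Real.abs_exp, Real.abs_exp, Real.exp_le_exp,
    neg_le_neg_iff]
  rw [div_le_iff₀ hk] at hm
  nlinarith

end DataMarket

open DataMarket
theorem theorem4
    {Ω : Type*} [MeasurableSpace Ω] (P : Measure Ω) [IsProbabilityMeasure P]
    {n : ℕ}
    -- the density of the privacy sensitivities
    (f : ℝ → ℝ) (hf : IsCostDensity f)
    (hψ : StrictMonoOn (virtualCost f) {c | 0 ≤ c ∧ 0 < f c})
    (hf_pos : ∃ c₁ > 0, ∀ c ∈ Icc (0 : ℝ) c₁, 0 < f c)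
    (hf_cont : ContinuousWithinAt f (Ici 0) 0)
    -- the distribution of the data
    (𝒟 : Measure (DataPoint n)) [IsProbabilityMeasure 𝒟]
    (h𝒟 : ∀ᵐ z ∂𝒟, ‖z.1‖ ≤ 1 ∧ (z.2 = 1 ∨ z.2 = -1))
    -- sensitivities, data points and noise vectors
    (c : ℕ → Ω → ℝ) (Z : ℕ → Ω → DataPoint n) (b : ℕ → Ω → Feat n)
    (hc_law : ∀ i, HasLaw (c i) (costLaw f) P) (hc_indep : iIndepFun c P)
    (hZ_law : ∀ i, HasLaw (Z i) 𝒟 P) (hZ_indep : iIndepFun Z P)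
    (hcZ : IndepFun (fun ω i => c i ω) (fun ω i => Z i ω) P)
    (hb_law : ∀ m, HasLaw (b m) (noiseLaw n) P)
    (hb_indep : ∀ m, IndepFun (b m) (fun ω => ((fun i => c i ω), (fun i => Z i ω))) P)
    -- the data set is linearly separable with margin `ρ`
    (ρ : ℝ) (hρ : 0 < ρ)
    (hsep : ∀ᵐ ω ∂P, ∃ w : Feat n, ‖w‖ = 1 ∧ ∀ i, ρ ≤ inner ℝ w (Z i ω).1 * (Z i ω).2)
    -- parameters
    (β γ ξ ν : ℝ) (hβ : 0 < β) (hγ : 0 < γ) (hξ : ξ ∈ Ioc (0 : ℝ) 1) (hν : 0 < ν)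
    -- the choice of the hyperparameters
    (E δ δ' μ σ : ℕ → ℝ)
    (hE : Tendsto E atTop (𝓝 (proxyConst ξ (virtualCostDensity f 0))))
    (hδ : ∀ m, δ m = Real.exp (-(deltaRate (E m) γ β * ν * (m : ℝ) ^ (1 / 4 : ℝ))))
    (hμ : ∀ m, μ m = muParam (δ m) β)
    (hσ : ∀ m, σ m = sigmaParam n (δ m) (δ' m) β)
    (hδ' : ∀ᶠ m in atTop, δ' m ∈ Ioo (0 : ℝ) 1 ∧ σ m = μ m ^ 2)
    -- the model weights
    (w : ℕ → Ω → Feat n) :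
    ∃ r : ℕ → ℝ, Tendsto r atTop (𝓝 0) ∧
      (fun m : ℕ => P.real {ω |
          IsOnlineSolution f (μ m) (σ m) γ m ⌊ξ * m⌋₊ (fun i => c i ω) (fun i => Z i ω) (b m ω)
            (w m ω) ∧
          ‖w m ω‖ = β ∧
          Real.logb 2 (1 + Real.exp (-(ρ * β))) + ν + r m ≤
            buyerObjective 𝒟 γ ⌊ξ * m⌋₊ (w m ω)
              (fun i => payment (onlineEps f (μ m) (σ m) γ m) (c i ω))})
        =O[atTop] fun m : ℕ => Real.exp (-(ν * ξ * (m : ℝ) ^ (1 / 4 : ℝ) / (2 * β))) := by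
  obtain ⟨c₁, hc₁, hpos⟩ := hf_pos
  have hf0 : 0 < f 0 := hpos 0 ⟨le_rfl, hc₁.le⟩
  have hpf := virtualCostDensity_zero hf hψ ⟨c₁, hc₁, hpos⟩ hf_cont
  set p := f 0 / 2 with hp_def
  have hp : 0 < p := by positivity
  rw [hpf] at hE
  obtain ⟨hξ0, hξ1⟩ := hξ
  have hQ : 0 < p ^ (1 / 4 : ℝ) := by positivity
  have hG : 0 < γ ^ (1 / 4 : ℝ) := by positivity
  -- the limit `H` of the largest guarantee
  have hEQ := proxyConst_mul hξ0 hp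
  have hsqrt : 0 < √ξ := Real.sqrt_pos.2 hξ0
  have hE₀ : 0 < proxyConst ξ p := by
    refine pos_of_mul_pos_left ?_ hQ.le
    rw [hEQ]
    positivity
  set H := 6 * ν / (proxyConst ξ p * p ^ (1 / 4 : ℝ)) with hH
  have hH0 : 0 < H := by positivity
  -- this is where `ξ ≤ 1` and the choice of `E` enter
  have hHξ : H ≤ ν / ξ := by
    rw [hH, hEQ, div_le_div_iff₀ (by positivity) hξ0]
    have h1 : 1 ≤ 1 / ξ := (one_le_div hξ0).2 hξ1
    have h2 : 2 ≤ 2 / √ξ := by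
      rw [le_div_iff₀ hsqrt]
      linarith [Real.sqrt_le_one.2 hξ1]
    nlinarith
  have hlimH := tendsto_maxEps hγ hp hE₀ hE hδ hμ
  obtain ⟨t, ht, htfin, hcov⟩ := (isCompact_sphere (0 : Feat n) β).finite_cover_balls
    (e := ν / 50) (by positivity)
  set net := htfin.toFinset with hnet_def
  have hnet : Metric.sphere 0 β ⊆ ⋃ v ∈ (net : Set (Feat n)), Metric.ball v (ν / 50) := by
    rw [hnet_def, htfin.coe_toFinset]
    exact hcov
  have hnet_norm : ∀ v ∈ net, ‖v‖ ≤ β := fun v hv =>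
    (mem_sphere_zero_iff_norm.1 (ht (htfin.mem_toFinset.1 hv))).le
  -- the scale of the number of paid sellers is `K √m`
  set K := ξ * (p ^ (1 / 4 : ℝ)) ^ 2 / (γ ^ (1 / 4 : ℝ)) ^ 2 with hK
  have hK0 : 0 < K := by positivity
  have hT_lim := tendsto_costThreshold hγ hp
  have hT2_lim : Tendsto (fun m => costThreshold γ p m / 2) atTop (𝓝[>] 0) := by
    refine tendsto_nhdsWithin_iff.2 ⟨?_, ?_⟩
    · simpa using (tendsto_nhdsWithin_iff.1 hT_lim).1.div_const 2
    · filter_upwards [(tendsto_nhdsWithin_iff.1 hT_lim).2] with m hm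
      exact half_pos (mem_Ioi.1 hm)
  have hcdf := tendsto_virtualCostCDF_div hf hψ ⟨c₁, hc₁, hpos⟩ hf_cont
  set ζ := 1 - Real.exp (-((ν / 50) ^ 2 / logisticLoss (-β) ^ 2)) with hζ
  have hζ0 : 0 < ζ := by
    have hB : 0 < logisticLoss (-β) :=
      one_pos.trans_le (one_le_logisticLoss (neg_nonpos.2 hβ.le))
    rw [hζ, sub_pos, Real.exp_lt_one_iff]
    exact neg_neg_of_pos (by positivity)
  refine ⟨fun _ => 0, tendsto_const_nhds, ?_⟩
  set D := ν * ξ / (2 * β) with hD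
  have htarget : (fun m : ℕ => Real.exp (-(ν * ξ * (m : ℝ) ^ (1 / 4 : ℝ) / (2 * β)))) =
      fun m : ℕ => Real.exp (-(D * (m : ℝ) ^ (1 / 4 : ℝ))) := by
    ext m
    rw [hD]
    ring_nf
  rw [htarget]
  set s : ℕ → ℝ := fun m => K * ((m : ℝ) ^ (1 / 4 : ℝ)) ^ 2 with hs_def
  have hbig : ∀ k : ℝ, 0 < k → (fun m : ℕ => Real.exp (-(k * s m))) =O[atTop]
      fun m : ℕ => Real.exp (-(D * (m : ℝ) ^ (1 / 4 : ℝ))) := by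
    intro k hk
    simpa only [hs_def, ← mul_assoc] using isBigO_exp_neg_sq (mul_pos hk hK0) D
  set q := ν * H / (3200 * β) with hq_def
  have hq0 : 0 < q := by positivity
  have hsum := (((hbig (9 / 1000) (by norm_num)).add (hbig (1 / 20) (by norm_num))).add
    ((hbig (q / 2) (by positivity)).const_mul_left (2 ^ n))).add
    ((hbig (ζ / 5) (by positivity)).const_mul_left (net.card : ℝ))
  refine IsBigO.trans (IsBigO.of_bound' ?_) hsum
  filter_upwards [hδ', hlimH.eventually_const_lt (half_lt_self hH0),
    hlimH.eventually_lt_const (lt_of_le_of_lt hHξ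
      (div_lt_div_of_pos_right (show ν < 11 / 10 * ν by linarith) hξ0)),
    hT_lim.eventually (eventually_virtualCost_lt hf hψ ⟨c₁, hc₁, hpos⟩ hf_cont
      (κ := 1 / 10) (by norm_num) (by norm_num)),
    hT_lim.eventually (Ioo_mem_nhdsGT hc₁),
    (hcdf.comp hT_lim).eventually_lt_const (show p < 11 / 10 * p by linarith),
    (hcdf.comp hT2_lim).eventually_const_lt (show 9 / 10 * p < p by linarith),
    tendsto_natCast_atTop_atTop.eventually_ge_atTop (2 / ξ), eventually_gt_atTop 0]
    with m hσμ hh1 hh2 hcost hTc₁ hq1 hq2 hmξ hm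
  have hm' : (0 : ℝ) < m := by exact_mod_cast hm
  set T := costThreshold γ p m with hT
  set h := maxEps γ p (μ m) m with hh
  have hT0 : 0 < T := hTc₁.1
  have hh0 : 0 < h := (half_pos hH0).trans hh1
  have hμ0 : μ m ≠ 0 := by
    intro h0
    rw [hh, h0] at hh0
    simp [maxEps] at hh0
  have hs0 : 0 < s m := by positivity
  have hsT : s m = ξ * m * p * T := by
    rw [hT, costThreshold_eq hγ hp, hs_def, hK]
    dsimp only
    rw [mul_assoc ξ (m : ℝ) p]
    nth_rw 2 [← rpow_quarter_pow_four hm'.le]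
    nth_rw 2 [← rpow_quarter_pow_four hp.le]
    have : 0 < (m : ℝ) ^ (1 / 4 : ℝ) := by positivity
    field_simp
  have hγT : γ * T * s m = ξ := by
    have hTT : T * T = (γ * m * p)⁻¹ := by
      rw [hT, costThreshold, ← mul_inv, Real.mul_self_sqrt (by positivity)]
    rw [hsT]
    calc γ * T * (ξ * m * p * T) = ξ * (γ * m * p) * (T * T) := by ring
      _ = ξ := by
        rw [hTT, mul_assoc, mul_inv_cancel₀ (by positivity), mul_one]
  have hNle : (⌊ξ * m⌋₊ : ℝ) ≤ ξ * m := Nat.floor_le (by positivity)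
  have hNge : ξ * m / 2 ≤ (⌊ξ * m⌋₊ : ℝ) := by
    have h1 := Nat.lt_floor_add_one (ξ * (m : ℝ))
    rw [div_le_iff₀ hξ0] at hmξ
    linarith
  have hqT : (costLaw f).real (belowCost f T) ≤ 11 / 10 * p * T := ((div_lt_iff₀ hT0).1 hq1).le
  have hqT2 : 9 / 10 * p * (T / 2) ≤ (costLaw f).real (belowCost f (T / 2)) :=
    ((lt_div_iff₀ (half_pos hT0)).1 hq2).le
  have haT : h / T * T = h := div_mul_cancel₀ _ hT0.ne'
  have hmain := failure_probability_le hf hψ h𝒟 hc_law hc_indep hZ_law hZ_indep hcZ (hb_law m)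
    hsep hβ hγ (a := h / T) (T := T) (d := 11 / 20 * T) (s := s m) (κ := ν / 50) (r := q * s m)
    (X := ν) ⌊ξ * m⌋₊ (div_pos hh0 hT0) hT0 (by positivity)
    (fun c hc => (hcost.1 c hc.1 hc.2).trans (by linarith))
    (fun c hc => hpos c ⟨hc.1, hc.2.trans (by linarith [hTc₁.2])⟩) hs0 (by positivity)
    (by
      calc _ ≤ ξ * m * (11 / 10 * p * T) := by gcongr
        _ = 11 / 10 * s m := by rw [hsT]; ring)
    (by
      calc s m / 5 ≤ ξ * m / 2 * (9 / 10 * p * (T / 2)) := by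
            rw [hsT]
            have : 0 < ξ * m * p * T := by positivity
            linarith
        _ ≤ _ := by gcongr)
    hnet_norm hnet
    (by
      rw [haT]
      have h1 : γ * (11 / 20 * T * h * (13 / 10 * s m)) = 143 / 200 * (ξ * h) := by
        rw [← hγT]; ring
      have h2 : ξ * h < 11 / 10 * ν := by
        rw [lt_div_iff₀ hξ0] at hh2
        linarith
      have h3 : 4 * β * (q * s m) / (h * s m / 40) ≤ ν / 10 := by
        rw [div_le_iff₀ (by positivity), hq_def]
        have h4 : 4 * β * (ν * H / (3200 * β) * s m) = ν / 10 * (H / 2 * s m / 40) := by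
          field_simp
          norm_num
        rw [h4]
        gcongr
      rw [h1]
      linarith)
    (w m)
  rw [Real.norm_of_nonneg measureReal_nonneg, Real.norm_of_nonneg (by positivity)]
  have hnoise : q * s m / 2 = q / 2 * s m := by ring
  rw [hnoise] at hmain
  simp only [IsOnlineSolution, hσμ.2, onlineEps_eq_linearEps hγ hμ0 hpf hp hm, add_zero]
  simp only [add_assoc] at hmain ⊢
  exact hmain
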